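/- **Setting.** Consider the switched DAE $E_\sigma\dot x=A_\sigma x+B_\sigma u$, $y=C_\sigma x+D_\sigma u$ with $n$ states, switching times $0=t_0<t_1<t_2<\cdots$, and mode $(E_k,A_k,B_k,C_k,D_k)$ active on $[t_k,t_{k+1})$, $\tau_k:=t_{k+1}-t_k$; all pairs $(E_k,A_k)$ are regular, i.e. $\det(sE_k-A_k)\not\equiv 0$. Solutions $(x,u,y)$ on $[t_p,t_q)$ are tuples of piecewise-smooth distributions on $\mathbb R$ (sums $f_{\mathbb D}+\sum_{t\in T}D_t$ of a piecewise smooth function $f$ and of impulses $D_t\in\operatorname{span}\{\delta_t,\delta_t',\dots\}$ on a locally finite set $T$) for which the equations, restricted to $[t_p,t_q)$, hold as equations of piecewise-smooth distributions; $D(t^\pm):=f(t^\pm)$ and $D[t]$ is the impulse of $D$ at $t$. Let $p<q$. A class $\mathcal{KL}$ function is a map $\beta:\mathbb R_{\ge0}\times\mathbb R_{\ge0}\to\mathbb R_{\ge0}$ such that each $\beta(\cdot,t)$ is continuous and strictly increasing with $\beta(0,t)=0$, and each $\beta(r,\cdot)$ is decreasing with limit $0$ at $\infty$. The switched DAE is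 $[t_p,t_q)$-detectable with $\mathcal{KL}$-function $\beta$ if $\beta(r,t_q-t_p)<r$ for all $r>0$ and every solution $(x,0,0)$ on $[t_p,t_q)$ satisfies $|x(t^+)|\le\beta(|x(t_p^-)|,t-t_p)$ for all $t\in[t_p,t_q)$. **Construction of the correction.** Let $\mathcal N_k^q$ be the space of all values $e(t_k^-)$ of solutions of $E_\sigma\dot e=A_\sigma e$, $0=C_\sigma e$ on $[t_k,t_q)$, and $\mathcal W_k:=\mathcal N_k^{k+1}$. Let $S_k,T_k$ be invertible with $(S_kE_kT_k,S_kA_kT_k)=(\operatorname{diag}(I,N_k),\operatorname{diag}(J_k,I))$, $N_k$ nilpotent, and put $\Pi_k=T_k\operatorname{diag}(I,0)T_k^{-1}$, $A_k^{\rm diff}=T_k\operatorname{diag}(J_k,0)T_k^{-1}$, $E_k^{\rm imp}=T_k\operatorname{diag}(0,N_k)T_k^{-1}$, $C_k^{\rm diff}=C_k\Pi_k$. Stacking rows, let $$O_k^{\rm diff}=[C_k^{\rm diff}/C_k^{\rm diff}A_k^{\rm diff}/\cdots/C_k^{\rm diff}(A_k^{\rm diff})^{n-1}],\qquad O_k^{\rm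 imp}=[C_kE_k^{\rm imp}/\cdots/C_k(E_k^{\rm imp})^{n-1}].$$ For $p\le k\le q-1$ choose matrices with orthonormal columns $Z_k^{\rm diff},Z_k^{\rm imp},Z_k,M_k^q$ with images $\operatorname{im}(O_k^{\rm diff})^\top$, $\operatorname{im}(O_k^{\rm imp})^\top$, $\mathcal W_k^\perp$, $(\mathcal N_k^q)^\perp$, where $M_{q-1}^q=Z_{q-1}$, and matrices $U_k^{\rm imp},U_k^{\rm obs}$ with $-(O_k^{\rm imp})^\top U_k^{\rm imp}=Z_k^{\rm imp}$ and $Z_k=[\Pi_k^\top Z_k^{\rm diff},\,Z_k^{\rm imp}]\,U_k^{\rm obs}$; for $p\le k\le q-2$ choose $\Theta_k^q$ with $\operatorname{im}\Theta_k^q=(e^{-A_k^{\rm diff}\tau_k}\mathcal N_{k+1}^q)^\perp$ and $U_k^q$ with $M_k^q=[Z_k,\,\Pi_k^\top\Theta_k^q]\,U_k^q$. For an output mismatch $y^e$ set $z_k:=\mathfrak O_k(y^e_{[t_k,t_{k+1})}):=(U_k^{\rm obs})^\top(z_k^{\rm diff}/z_k^{\rm imp})$. Here $z_k^{\rm diff}=\mathbf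 z(t_k^+)$, where $\mathbf z$ is the trajectory on $(t_k,t_{k+1})$ of the observable ODE $\dot{\mathbf z}=(Z_k^{\rm diff})^\top A_k^{\rm diff}Z_k^{\rm diff}\,\mathbf z$ with $C_k^{\rm diff}Z_k^{\rm diff}\,\mathbf z=y^e$, and $z_k^{\rm imp}=(U_k^{\rm imp})^\top(\eta_k^0/\cdots/\eta_k^{n-2})$, where $y^e[t_k]=\sum_j\eta_k^j\delta_{t_k}^{(j)}$. Put $\mu_{q-1}=z_{q-1}$ and, for $k=q-2,\dots,p$, $$\mu_k=(U_k^q)^\top\begin{pmatrix}z_k\\ (\Theta_k^q)^\top e^{-A_k^{\rm diff}\tau_k}M_{k+1}^q\mu_{k+1}\end{pmatrix};$$ then $\xi^{\rm left}:=\mathcal O_p^{q-1}\mathbf z_p^{q-1}:=M_p^q\mu_p$, where $\mathbf z_p^{q-1}=(z_p/\cdots/z_{q-1})$, and $\xi:=\Phi_p^q\xi^{\rm left}$ with $\Phi_p^p=I$, $\Phi_p^{k+1}=e^{A_k^{\rm diff}\tau_k}\Pi_k\Phi_p^k$. **Theorem.** Let the switched DAE be $[t_p,t_q)$-detectable with $\mathcal{KL}$-function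 $\beta$, and let every $\beta(r,\cdot)$ be continuous from the left at $t_q-t_p$ (as it is if $\beta$ is continuous). Then all the choices in the construction are possible. For all such choices, all solutions $(x,u,y)$ of the switched DAE and $(\widehat x,u,\widehat y)$ of the system copy (the same switched DAE with the same input) on $[t_p,t_q)$, and $y^e=\widehat y-y$, $e=\widehat x-x$: 1. $z_k=Z_k^\top e(t_k^-)$ for $p\le k\le q-1$; 2. $\xi^{\rm left}\in(\mathcal N_p^q)^\perp$ and $e(t_p^-)-\xi^{\rm left}\in\mathcal N_p^q$, i.e. $\xi^{\rm left}$ is the orthogonal projection of $e(t_p^-)$ onto $(\mathcal N_p^q)^\perp$; 3. $|\widehat x(t_q^-)-\xi-x(t_q^-)|\le\beta(|\widehat x(t_p^-)-x(t_p^-)|,\,t_q-t_p)$; 4. $\beta(|\widehat x(t_p^-)-x(t_p^-)|,\,t_q-t_p)<|\widehat x(t_p^-)-x(t_p^-)|$ whenever $\widehat x(t_p^-)\ne x(t_p^-)$. -/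

import Mathlib

open Set Filter Topology MeasureTheory
open scoped ContDiff Distributions NNReal LineDeriv

noncomputable section

/-! ### Piecewise-smooth distributions -/

section PWDist

variable {V W : Type*} [NormedAddCommGroup V] [NormedSpace ℝ V]
  [NormedAddCommGroup W] [NormedSpace ℝ W]

/-- `f : ℝ → V` is piecewise smooth (with the usual right-continuous normalisation): near every
`t`, it coincides with a smooth function on the left of `t`, and with a smooth function on the
right of `t`, including `t` itself. By compactness this says that there is a locally finite set of
break points such that, on each of the half-open intervals `[t_i, t_{i+1})` which they cut out, `f`
is the restriction of a smooth function on `ℝ`. -/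
def IsPWSmooth (f : ℝ → V) : Prop :=
  ∀ t : ℝ, (∃ g : ℝ → V, ContDiff ℝ ∞ g ∧ f =ᶠ[𝓝[<] t] g) ∧
    (∃ g : ℝ → V, ContDiff ℝ ∞ g ∧ f =ᶠ[𝓝[≥] t] g)

theorem IsPWSmooth.zero : IsPWSmooth (0 : ℝ → V) := fun _ =>
  ⟨⟨0, contDiff_const, .rfl⟩, ⟨0, contDiff_const, .rfl⟩⟩

theorem IsPWSmooth.add {f g : ℝ → V} (hf : IsPWSmooth f) (hg : IsPWSmooth g) :
    IsPWSmooth (f + g) := by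
  intro t
  obtain ⟨⟨a, ha, ha'⟩, ⟨b, hb, hb'⟩⟩ := hf t
  obtain ⟨⟨c, hc, hc'⟩, ⟨d, hd, hd'⟩⟩ := hg t
  exact ⟨⟨a + c, ha.add hc, ha'.add hc'⟩, ⟨b + d, hb.add hd, hb'.add hd'⟩⟩

theorem IsPWSmooth.map {f : ℝ → V} (hf : IsPWSmooth f) (L : V →L[ℝ] W) :
    IsPWSmooth (fun t => L (f t)) := by
  intro t
  obtain ⟨⟨a, ha, ha'⟩, ⟨b, hb, hb'⟩⟩ := hf t
  exact ⟨⟨fun t => L (a t), L.contDiff.comp ha, ha'.fun_comp L⟩,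
    ⟨fun t => L (b t), L.contDiff.comp hb, hb'.fun_comp L⟩⟩

theorem IsPWSmooth.smul {f : ℝ → V} (hf : IsPWSmooth f) (c : ℝ) : IsPWSmooth (c • f) :=
  hf.map (c • ContinuousLinearMap.id ℝ V)

theorem IsPWSmooth.indicator {f : ℝ → V} (hf : IsPWSmooth f) (a b : ℝ) :
    IsPWSmooth ((Ico a b).indicator f) := by
  intro t
  obtain ⟨⟨g, hg, hg'⟩, ⟨h, hh, hh'⟩⟩ := hf t
  have key : ∀ (l : Filter ℝ) (k : ℝ → V), ContDiff ℝ ∞ k → f =ᶠ[l] k →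
      ((∀ᶠ s in l, s ∈ Ico a b) ∨ (∀ᶠ s in l, s ∉ Ico a b)) →
      ∃ g : ℝ → V, ContDiff ℝ ∞ g ∧ (Ico a b).indicator f =ᶠ[l] g := by
    intro l k hk hfk h
    rcases h with h | h
    · refine ⟨k, hk, ?_⟩
      filter_upwards [h, hfk] with s hs hs'
      rw [indicator_of_mem hs, hs']
    · refine ⟨0, contDiff_const, ?_⟩
      filter_upwards [h] with s hs
      rw [indicator_of_notMem hs]; rfl
  refine ⟨key _ g hg hg' ?_, key _ h hh hh' ?_⟩
  · rcases le_or_gt t a with h1 | h1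
    · right
      filter_upwards [self_mem_nhdsWithin] with s hs hs'
      exact absurd hs'.1 (not_le.2 (lt_of_lt_of_le hs h1))
    · rcases le_or_gt t b with h2 | h2
      · left
        filter_upwards [self_mem_nhdsWithin, mem_nhdsWithin_of_mem_nhds (lt_mem_nhds h1)]
          with s hs hs'
        exact ⟨le_of_lt hs', lt_of_lt_of_le hs h2⟩
      · right
        filter_upwards [mem_nhdsWithin_of_mem_nhds (lt_mem_nhds h2)] with s hs hs'
        exact absurd hs'.2 (not_lt.2 (le_of_lt hs))
  · rcases lt_or_ge t a with h1 | h1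
    · right
      filter_upwards [mem_nhdsWithin_of_mem_nhds (gt_mem_nhds h1)] with s hs hs'
      exact absurd hs'.1 (not_le.2 hs)
    · rcases lt_or_ge t b with h2 | h2
      · left
        filter_upwards [self_mem_nhdsWithin, mem_nhdsWithin_of_mem_nhds (gt_mem_nhds h2)]
          with s hs hs'
        exact ⟨le_trans h1 hs, hs'⟩
      · right
        filter_upwards [self_mem_nhdsWithin] with s hs hs'
        exact absurd hs'.2 (not_lt.2 (le_trans h2 hs))

/-- Near `t`, to the left of `t`, a piecewise smooth function is locally smooth. -/
theorem IsPWSmooth.left {f : ℝ → V} (hf : IsPWSmooth f) (t : ℝ) :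
    ∃ g : ℝ → V, ContDiff ℝ ∞ g ∧ ∀ᶠ s in 𝓝[<] t, f =ᶠ[𝓝 s] g := by
  obtain ⟨⟨g, hg, hg'⟩, -⟩ := hf t
  refine ⟨g, hg, ?_⟩
  filter_upwards [eventually_eventually_nhdsWithin.2 hg', self_mem_nhdsWithin] with s hs hs'
  rwa [isOpen_Iio.nhdsWithin_eq hs'] at hs

/-- Near `t`, to the right of `t`, a piecewise smooth function is locally smooth. -/
theorem IsPWSmooth.right {f : ℝ → V} (hf : IsPWSmooth f) (t : ℝ) :
    ∃ g : ℝ → V, ContDiff ℝ ∞ g ∧ (∀ᶠ s in 𝓝[≥] t, f =ᶠ[𝓝[≥] s] g) ∧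
      ∀ᶠ s in 𝓝[>] t, f =ᶠ[𝓝 s] g := by
  obtain ⟨-, ⟨g, hg, hg'⟩⟩ := hf t
  refine ⟨g, hg, ?_, ?_⟩
  · filter_upwards [eventually_eventually_nhdsWithin.2 hg', self_mem_nhdsWithin] with s hs hs'
    exact hs.filter_mono (nhdsWithin_mono _ (Ici_subset_Ici.2 hs'))
  · have h2 : ∀ᶠ s in 𝓝[>] t, f s = g s := hg'.filter_mono (nhdsWithin_mono _ Ioi_subset_Ici_self)
    filter_upwards [eventually_eventually_nhdsWithin.2 h2, self_mem_nhdsWithin] with s hs hs'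
    rwa [isOpen_Ioi.nhdsWithin_eq hs'] at hs

theorem IsPWSmooth.hasDerivWithinAt {f : ℝ → V} (hf : IsPWSmooth f) (t : ℝ) :
    HasDerivWithinAt f (derivWithin f (Ici t) t) (Ici t) t := by
  obtain ⟨-, ⟨g, hg, hg'⟩⟩ := hf t
  have h1 : HasDerivWithinAt f (deriv g t) (Ici t) t :=
    ((hg.differentiable (by simp) t).hasDerivAt.hasDerivWithinAt).congr_of_eventuallyEq hg'
      (hg'.self_of_nhdsWithin (mem_Ici.2 le_rfl))
  exact h1.differentiableWithinAt.hasDerivWithinAt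

theorem IsPWSmooth.derivWithin {f : ℝ → V} (hf : IsPWSmooth f) :
    IsPWSmooth (fun t => derivWithin f (Ici t) t) := by
  intro t
  have key : ∀ (g : ℝ → V) (s : ℝ), ContDiff ℝ ∞ g → f =ᶠ[𝓝[≥] s] g →
      _root_.derivWithin f (Ici s) s = deriv g s := by
    intro g s hg h
    rw [h.derivWithin_eq (h.self_of_nhdsWithin (mem_Ici.2 le_rfl))]
    exact (hg.differentiable (by simp) s).derivWithin (uniqueDiffWithinAt_Ici s)
  constructor
  · obtain ⟨g, hg, h⟩ := hf.left t
    refine ⟨deriv g, (contDiff_infty_iff_deriv.1 hg).2, ?_⟩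
    filter_upwards [h] with s hs using key g s hg (hs.filter_mono nhdsWithin_le_nhds)
  · obtain ⟨g, hg, h, -⟩ := hf.right t
    refine ⟨deriv g, (contDiff_infty_iff_deriv.1 hg).2, ?_⟩
    filter_upwards [h] with s hs using key g s hg hs

theorem IsPWSmooth.tendsto_left {f : ℝ → V} (hf : IsPWSmooth f) (t : ℝ) :
    Tendsto f (𝓝[<] t) (𝓝 (limUnder (𝓝[<] t) f)) := by
  obtain ⟨⟨g, hg, hg'⟩, -⟩ := hf t
  refine tendsto_nhds_limUnder ⟨g t, ?_⟩
  exact ((hg.continuous.tendsto t).mono_left nhdsWithin_le_nhds).congr' hg'.symm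

theorem IsPWSmooth.eventually_jump {f : ℝ → V} (hf : IsPWSmooth f) (t : ℝ) :
    ∀ᶠ s in 𝓝[≠] t, f s - limUnder (𝓝[<] s) f = 0 := by
  have key : ∀ (g : ℝ → V) (s : ℝ), ContDiff ℝ ∞ g → f =ᶠ[𝓝 s] g →
      f s - limUnder (𝓝[<] s) f = 0 := by
    intro g s hg h
    have h2 : Tendsto f (𝓝[<] s) (𝓝 (f s)) := by
      rw [h.self_of_nhds]
      exact ((hg.continuous.tendsto s).mono_left nhdsWithin_le_nhds).congr'
        (h.filter_mono nhdsWithin_le_nhds).symm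
    rw [h2.limUnder_eq, sub_self]
  rw [← Iio_union_Ioi, nhdsWithin_union, eventually_sup]
  obtain ⟨g, hg, h⟩ := hf.left t
  obtain ⟨k, hk, -, h'⟩ := hf.right t
  exact ⟨h.mono fun s hs => key g s hg hs, h'.mono fun s hs => key k s hk hs⟩

variable (V) in
/-- The space of pairs `(f, α)` where `f` is a piecewise smooth function and `α t : ℕ →₀ V` are the
coefficients of the impulse `∑ j, α t j • δ_t^{(j)}` at `t`, nonzero only on a locally finite set
of times `t`. -/
def pwDistSubmodule : Submodule ℝ ((ℝ → V) × (ℝ → ℕ →₀ V)) where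
  carrier := {D | IsPWSmooth D.1 ∧ ∀ t, ∀ᶠ s in 𝓝[≠] t, D.2 s = 0}
  zero_mem' := ⟨IsPWSmooth.zero, fun _ => Eventually.of_forall fun _ => rfl⟩
  add_mem' := by
    rintro D D' ⟨h1, h2⟩ ⟨h3, h4⟩
    refine ⟨h1.add h3, fun t => ?_⟩
    filter_upwards [h2 t, h4 t] with s hs hs'
    simp [hs, hs']
  smul_mem' := by
    rintro c D ⟨h1, h2⟩
    refine ⟨h1.smul c, fun t => ?_⟩
    filter_upwards [h2 t] with s hs
    simp [hs]

variable (V) in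
/-- `V`-valued piecewise-smooth distributions `D = f_𝔻 + ∑_t D_t` on `ℝ`, stored through their
regular part `f` (right-continuous piecewise smooth) and the coefficients `α` of their impulses
`D_t = ∑ j, α t j • δ_t^{(j)}`. The distribution itself is `PWDist.toDistribution D`;
`PWDist.toDistribution_injective` says that nothing is lost or added in this description. -/
def PWDist : Type _ := pwDistSubmodule V

namespace PWDist

instance : AddCommGroup (PWDist V) := inferInstanceAs (AddCommGroup (pwDistSubmodule V))

instance : Module ℝ (PWDist V) := inferInstanceAs (Module ℝ (pwDistSubmodule V))

/-- The regular part `f` of `D = f_𝔻 + ∑_t D_t`. -/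
def reg : PWDist V →ₗ[ℝ] (ℝ → V) := LinearMap.fst ℝ _ _ ∘ₗ (pwDistSubmodule V).subtype

/-- The impulsive part: `D.imp t j` is the coefficient of `δ_t^{(j)}` in `D[t]`. -/
def imp : PWDist V →ₗ[ℝ] (ℝ → ℕ →₀ V) := LinearMap.snd ℝ _ _ ∘ₗ (pwDistSubmodule V).subtype

theorem isPWSmooth (D : PWDist V) : IsPWSmooth (reg D) := D.2.1

theorem eventually_imp (D : PWDist V) (t : ℝ) : ∀ᶠ s in 𝓝[≠] t, imp D s = 0 := D.2.2 t

theorem ext {D D' : PWDist V} (h1 : reg D = reg D') (h2 : imp D = imp D') : D = D' :=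
  Subtype.ext (Prod.ext h1 h2)

/-- `D(t⁻)`, the limit from the left of the regular part. -/
def leftVal (t : ℝ) : PWDist V →ₗ[ℝ] V where
  toFun D := limUnder (𝓝[<] t) (reg D)
  map_add' D D' := by
    rw [map_add]
    exact ((D.isPWSmooth.tendsto_left t).add (D'.isPWSmooth.tendsto_left t)).limUnder_eq
  map_smul' c D := by
    rw [map_smul]
    exact ((D.isPWSmooth.tendsto_left t).const_smul c).limUnder_eq

/-- `D(t⁺)`, the limit from the right of the regular part; as the regular part is
right-continuous, this is its value at `t`. -/
def rightVal (t : ℝ) : PWDist V →ₗ[ℝ] V := LinearMap.proj t ∘ₗ reg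

theorem tendsto_leftVal (D : PWDist V) (t : ℝ) : Tendsto (reg D) (𝓝[<] t) (𝓝 (leftVal t D)) :=
  D.isPWSmooth.tendsto_left t

theorem tendsto_rightVal (D : PWDist V) (t : ℝ) :
    Tendsto (reg D) (𝓝[>] t) (𝓝 (rightVal t D)) :=
  ((D.isPWSmooth.hasDerivWithinAt t).continuousWithinAt.tendsto).mono_left
    (nhdsWithin_mono _ Ioi_subset_Ici_self)

/-- A constant matrix (continuous linear map) times a piecewise-smooth distribution. -/
def map (L : V →L[ℝ] W) : PWDist V →ₗ[ℝ] PWDist W where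
  toFun D := ⟨(fun t => L (reg D t), fun t => (imp D t).mapRange L L.map_zero),
    D.isPWSmooth.map L, fun t => by
      filter_upwards [D.eventually_imp t] with s hs
      simp [hs]⟩
  map_add' D D' := by
    apply PWDist.ext
    · funext t
      change L (reg (D + D') t) = L (reg D t) + L (reg D' t)
      rw [map_add, Pi.add_apply, map_add]
    · funext t
      ext j
      change L (imp (D + D') t j) = L (imp D t j) + L (imp D' t j)
      rw [map_add, Pi.add_apply, Finsupp.add_apply, map_add]
  map_smul' c D := by
    apply PWDist.ext
    · funext t
      change L (reg (c • D) t) = c • L (reg D t)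
      rw [map_smul, Pi.smul_apply, map_smul]
    · funext t
      ext j
      change L (imp (c • D) t j) = c • L (imp D t j)
      rw [map_smul, Pi.smul_apply, Finsupp.smul_apply, map_smul]

/-- The restriction `D_{[a,b)} = 𝟙_{[a,b)} D` to a half-open interval: the regular part is
multiplied by the indicator function, and the impulses at times outside `[a,b)` are removed. -/
def restrict (a b : ℝ) : PWDist V →ₗ[ℝ] PWDist V where
  toFun D := ⟨((Ico a b).indicator (reg D), (Ico a b).indicator (imp D)),
    D.isPWSmooth.indicator a b, fun t => by
      filter_upwards [D.eventually_imp t] with s hs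
      by_cases h : s ∈ Ico a b <;> simp [h, hs]⟩
  map_add' D D' := by
    apply PWDist.ext
    · change (Ico a b).indicator (reg (D + D')) = _
      rw [map_add, indicator_add']
      rfl
    · change (Ico a b).indicator (imp (D + D')) = _
      rw [map_add, indicator_add']
      rfl
  map_smul' c D := by
    apply PWDist.ext
    · change (Ico a b).indicator (reg (c • D)) = _
      rw [map_smul]
      exact indicator_const_smul _ c _
    · change (Ico a b).indicator (imp (c • D)) = _
      rw [map_smul]
      exact indicator_const_smul _ c _

/-- The derivative of a piecewise-smooth distribution: the regular part is differentiated
piecewise, every jump `D(t⁺) - D(t⁻)` gives a Dirac impulse at `t`, and `δ_t^{(j)}` becomes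
`δ_t^{(j+1)}`. By `PWDist.toDistribution_deriv` this is the distributional derivative. -/
def deriv : PWDist V →ₗ[ℝ] PWDist V where
  toFun D := ⟨(fun t => derivWithin (reg D) (Ici t) t,
      fun t => Finsupp.single 0 (rightVal t D - leftVal t D) + (imp D t).mapDomain Nat.succ),
    D.isPWSmooth.derivWithin, fun t => by
      filter_upwards [D.eventually_imp t, D.isPWSmooth.eventually_jump t] with s hs hs'
      have h : rightVal s D - leftVal s D = 0 := hs'
      simp [hs, h]⟩
  map_add' D D' := by
    apply PWDist.ext
    · funext t
      change derivWithin (reg (D + D')) (Ici t) t = derivWithin (reg D) (Ici t) t +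
        derivWithin (reg D') (Ici t) t
      rw [map_add]
      exact ((D.isPWSmooth.hasDerivWithinAt t).add (D'.isPWSmooth.hasDerivWithinAt t)).derivWithin
        (uniqueDiffWithinAt_Ici t)
    · funext t
      change Finsupp.single 0 (rightVal t (D + D') - leftVal t (D + D')) +
        (imp (D + D') t).mapDomain Nat.succ =
        (Finsupp.single 0 (rightVal t D - leftVal t D) + (imp D t).mapDomain Nat.succ) +
        (Finsupp.single 0 (rightVal t D' - leftVal t D') + (imp D' t).mapDomain Nat.succ)
      simp only [map_add, Pi.add_apply, Finsupp.mapDomain_add, add_sub_add_comm,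
        Finsupp.single_add]
      abel
  map_smul' c D := by
    apply PWDist.ext
    · funext t
      change derivWithin (reg (c • D)) (Ici t) t = c • derivWithin (reg D) (Ici t) t
      rw [map_smul]
      exact ((D.isPWSmooth.hasDerivWithinAt t).const_smul c).derivWithin
        (uniqueDiffWithinAt_Ici t)
    · funext t
      change Finsupp.single 0 (rightVal t (c • D) - leftVal t (c • D)) +
        (imp (c • D) t).mapDomain Nat.succ =
        c • (Finsupp.single 0 (rightVal t D - leftVal t D) + (imp D t).mapDomain Nat.succ)
      simp only [map_smul, Pi.smul_apply, Finsupp.mapDomain_smul, smul_add, ← smul_sub,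
        Finsupp.smul_single]

/-- The `j`-th distributional derivative `δ_t^{(j)}` of the Dirac impulse at `t`. -/
def diracDeriv (t : ℝ) : ℕ → 𝓓'((⊤ : TopologicalSpace.Opens ℝ), ℝ)
  | 0 => Distribution.delta t
  | j + 1 => ∂_{(1 : ℝ)} (diracDeriv t j)

theorem diracDeriv_succ (t : ℝ) (j : ℕ) (φ : 𝓓((⊤ : TopologicalSpace.Opens ℝ), ℝ)) :
    diracDeriv t (j + 1) φ = diracDeriv t j (-∂_{(1 : ℝ)} φ) := by
  rw [diracDeriv, Distribution.lineDerivOp_apply_apply]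

theorem coe_lineDeriv (φ : 𝓓((⊤ : TopologicalSpace.Opens ℝ), ℝ)) :
    ((∂_{(1 : ℝ)} φ : 𝓓((⊤ : TopologicalSpace.Opens ℝ), ℝ)) : ℝ → ℝ) = _root_.deriv φ := by
  funext t
  have h : DifferentiableAt ℝ φ t := (φ.contDiff.differentiable (by simp)) t
  simp [TestFunction.lineDerivOp_eq_lineDerivCLM ℝ, h.lineDeriv_eq_fderiv]

theorem tsupport_neg_lineDeriv (φ : 𝓓((⊤ : TopologicalSpace.Opens ℝ), ℝ)) :
    tsupport ((-∂_{(1 : ℝ)} φ : 𝓓((⊤ : TopologicalSpace.Opens ℝ), ℝ)) : ℝ → ℝ) ⊆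
      tsupport φ := by
  have : ((-∂_{(1 : ℝ)} φ : 𝓓((⊤ : TopologicalSpace.Opens ℝ), ℝ)) : ℝ → ℝ) =
      -_root_.deriv φ := by
    rw [← coe_lineDeriv]; rfl
  rw [this]
  refine closure_minimal ?_ (isClosed_tsupport _)
  intro s hs
  rw [Function.support_neg] at hs
  exact support_deriv_subset hs

theorem diracDeriv_eq_zero {t : ℝ} (j : ℕ) (φ : 𝓓((⊤ : TopologicalSpace.Opens ℝ), ℝ))
    (h : t ∉ tsupport φ) : diracDeriv t j φ = 0 := by
  induction j generalizing φ with
  | zero => exact (image_eq_zero_of_notMem_tsupport h : φ t = 0)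
  | succ j ih =>
    rw [diracDeriv_succ]
    exact ih _ fun h' => h (tsupport_neg_lineDeriv φ h')

/-- The value `D[t](φ)` of an impulse `D[t] = ∑ j, a j • δ_t^{(j)}`. -/
def impulse (t : ℝ) (φ : 𝓓((⊤ : TopologicalSpace.Opens ℝ), ℝ)) : (ℕ →₀ V) →ₗ[ℝ] V :=
  Finsupp.lsum ℝ fun j => diracDeriv t j φ • LinearMap.id

theorem impulse_apply (t : ℝ) (φ : 𝓓((⊤ : TopologicalSpace.Opens ℝ), ℝ)) (a : ℕ →₀ V) :
    impulse t φ a = a.sum fun j v => diracDeriv t j φ • v := rfl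

theorem impulse_add (t : ℝ) (φ ψ : 𝓓((⊤ : TopologicalSpace.Opens ℝ), ℝ)) (a : ℕ →₀ V) :
    impulse t (φ + ψ) a = impulse t φ a + impulse t ψ a := by
  simp [impulse_apply, map_add, add_smul, Finsupp.sum_add]

theorem impulse_smul (t c : ℝ) (φ : 𝓓((⊤ : TopologicalSpace.Opens ℝ), ℝ)) (a : ℕ →₀ V) :
    impulse t (c • φ) a = c • impulse t φ a := by
  simp [impulse_apply, map_smul, mul_smul, Finsupp.smul_sum]

theorem continuous_impulse (t : ℝ) (a : ℕ →₀ V) : Continuous fun φ => impulse t φ a := by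
  simp only [impulse_apply, Finsupp.sum]
  exact continuous_finsetSum _ fun j _ => (diracDeriv t j).continuous.smul continuous_const

theorem impulse_eq_zero {t : ℝ} {φ : 𝓓((⊤ : TopologicalSpace.Opens ℝ), ℝ)}
    (h : t ∉ tsupport φ) (a : ℕ →₀ V) : impulse t φ a = 0 := by
  simp [impulse_apply, diracDeriv_eq_zero _ φ h]

theorem finite_of_locally {S K : Set ℝ} (h : ∀ t, ∀ᶠ s in 𝓝[≠] t, s ∉ S) (hK : IsCompact K) :
    (K ∩ S).Finite := by
  by_contra hinf
  obtain ⟨t, -, ht⟩ := Set.Infinite.exists_accPt_of_subset_isCompact hinf hK inter_subset_left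
  rw [accPt_iff_frequently_nhdsNE] at ht
  exact ht ((h t).mono fun s hs hs' => hs hs'.2)

theorem finite_imp (D : PWDist V) {K : Set ℝ} (hK : IsCompact K) :
    (K ∩ {t | imp D t ≠ 0}).Finite :=
  finite_of_locally (fun t => (D.eventually_imp t).mono fun _ hs hs' => hs' hs) hK

theorem support_impulse_subset (D : PWDist V) {K : Set ℝ}
    {φ : 𝓓((⊤ : TopologicalSpace.Opens ℝ), ℝ)} (hφ : tsupport φ ⊆ K) :
    (Function.support fun t => impulse t φ (imp D t)) ⊆ K ∩ {t | imp D t ≠ 0} := by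
  intro t ht
  refine ⟨hφ ?_, fun h => ht ?_⟩
  · by_contra h
    exact ht (impulse_eq_zero h _)
  · change impulse t φ (imp D t) = 0
    rw [h, map_zero]

theorem finite_support_impulse (D : PWDist V) (φ : 𝓓((⊤ : TopologicalSpace.Opens ℝ), ℝ)) :
    (Function.support fun t => impulse t φ (imp D t)).Finite :=
  (finite_imp D φ.hasCompactSupport).subset (support_impulse_subset D subset_rfl)

theorem locallyIntegrable_reg (D : PWDist V) : LocallyIntegrable (reg D) := by
  intro t
  have h : 𝓝 t = 𝓝[<] t ⊔ 𝓝[≥] t := by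
    rw [← nhdsWithin_union, Iio_union_Ici, nhdsWithin_univ]
  obtain ⟨⟨f, hf, hf'⟩, ⟨g, hg, hg'⟩⟩ := D.isPWSmooth t
  have key : ∀ (l : Filter ℝ) (k : ℝ → V), l.IsMeasurablyGenerated → l ≤ 𝓝 t →
      ContDiff ℝ ∞ k → reg D =ᶠ[l] k → IntegrableAtFilter (reg D) l := by
    intro l k hm hl hk h
    obtain ⟨s, hs, hs'⟩ := (hk.continuous.locallyIntegrable (μ := volume) t).filter_mono hl
    obtain ⟨u, hu, hu', hu''⟩ := h.exists_measurable_mem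
    refine ⟨s ∩ u, inter_mem hs hu, ?_⟩
    refine (hs'.mono_set inter_subset_left).congr ?_
    have : ∀ᵐ x ∂(volume.restrict s).restrict u, k x = reg D x :=
      ae_restrict_of_forall_mem hu' fun x hx => (hu'' x hx).symm
    rwa [Measure.restrict_restrict hu', inter_comm] at this
  rw [h, IntegrableAtFilter.sup_iff]
  exact ⟨key _ f inferInstance nhdsWithin_le_nhds hf hf',
    key _ g inferInstance nhdsWithin_le_nhds hg hg'⟩

theorem integrable_smul_reg (D : PWDist V) (φ : 𝓓((⊤ : TopologicalSpace.Opens ℝ), ℝ)) :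
    Integrable fun t => φ t • reg D t :=
  φ.integrable_bilin (ContinuousLinearMap.lsmul ℝ ℝ : ℝ →L[ℝ] V →L[ℝ] V)
    (D.locallyIntegrable_reg.locallyIntegrableOn _)

/-- The distribution `φ ↦ ∫ φ f + ∑_t D[t](φ)` which is described by `D`. -/
def toDistribution : PWDist V →ₗ[ℝ] 𝓓'((⊤ : TopologicalSpace.Opens ℝ), V) where
  toFun D := TestFunction.mkCLM ℝ
    (fun φ => (∫ t, φ t • reg D t) + ∑ᶠ t, impulse t φ (imp D t))
    (by
      intro φ ψ
      have h1 : ∫ t, (φ + ψ) t • reg D t = (∫ t, φ t • reg D t) + ∫ t, ψ t • reg D t := by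
        rw [← integral_add (integrable_smul_reg D φ) (integrable_smul_reg D ψ)]
        simp [add_smul]
      simp only [h1, impulse_add]
      rw [finsum_add_distrib (finite_support_impulse D φ) (finite_support_impulse D ψ)]
      abel)
    (by
      intro c φ
      have h1 : ∫ t, (c • φ) t • reg D t = c • ∫ t, φ t • reg D t := by
        rw [← integral_smul]
        simp [mul_smul]
      simp only [h1, impulse_smul, ← smul_finsum, smul_add])
    (by
      intro K hK
      have h1 := ((TestFunction.integralAgainstBilinCLM (n := ⊤) (Ω := ⊤)
        (ContinuousLinearMap.lsmul ℝ ℝ : ℝ →L[ℝ] V →L[ℝ] V) volume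
        (reg D)).continuous).comp (TestFunction.continuous_ofSupportedIn hK)
      have h2 : Continuous fun φ => ∑ t ∈ (finite_imp D K.isCompact).toFinset,
          impulse t φ (imp D t) :=
        continuous_finsetSum _ fun t _ => continuous_impulse t _
      refine (h1.add (h2.comp (TestFunction.continuous_ofSupportedIn hK))).congr fun φ => ?_
      refine congrArg₂ (fun a b : V => a + b) ?_ ?_
      · rw [Function.comp_apply]
        rw [TestFunction.integralAgainstBilinCLM_eq_integral
          (D.locallyIntegrable_reg.locallyIntegrableOn _)]
        rfl
      · symm
        apply finsum_eq_sum_of_support_subset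
        rw [Set.Finite.coe_toFinset]
        exact support_impulse_subset D φ.tsupport_subset)
  map_add' D D' := by
    ext φ
    change (∫ t, φ t • reg (D + D') t) + ∑ᶠ t, impulse t φ (imp (D + D') t) =
      ((∫ t, φ t • reg D t) + ∑ᶠ t, impulse t φ (imp D t)) +
      ((∫ t, φ t • reg D' t) + ∑ᶠ t, impulse t φ (imp D' t))
    simp only [map_add, Pi.add_apply, smul_add]
    rw [integral_add (integrable_smul_reg D φ) (integrable_smul_reg D' φ),
      finsum_add_distrib (finite_support_impulse D φ) (finite_support_impulse D' φ)]
    abel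
  map_smul' c D := by
    ext φ
    change (∫ t, φ t • reg (c • D) t) + ∑ᶠ t, impulse t φ (imp (c • D) t) =
      c • ((∫ t, φ t • reg D t) + ∑ᶠ t, impulse t φ (imp D t))
    simp only [map_smul, Pi.smul_apply, smul_comm _ c, ← smul_finsum, smul_add]
    rw [integral_smul]

theorem toDistribution_apply (D : PWDist V) (φ : 𝓓((⊤ : TopologicalSpace.Opens ℝ), ℝ)) :
    toDistribution D φ = (∫ t, φ t • reg D t) + ∑ᶠ t, impulse t φ (imp D t) := rfl

theorem eventually_const_indicator {X : Type*} [Zero X] (t s : ℝ) (c : X) :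
    ∀ᶠ r in 𝓝[≥] s, (Ici t).indicator (fun _ => c) r = (Ici t).indicator (fun _ => c) s := by
  rcases le_or_gt t s with h | h
  · filter_upwards [self_mem_nhdsWithin] with r hr
    rw [indicator_of_mem (mem_Ici.2 (h.trans hr)), indicator_of_mem (mem_Ici.2 h)]
  · filter_upwards [mem_nhdsWithin_of_mem_nhds (gt_mem_nhds h)] with r hr
    rw [indicator_of_notMem (notMem_Ici.2 hr), indicator_of_notMem (notMem_Ici.2 h)]

theorem eventually_const_indicator_left {X : Type*} [Zero X] (t s : ℝ) (c : X) :
    ∀ᶠ r in 𝓝[<] s, (Ici t).indicator (fun _ => c) r = (Ioi t).indicator (fun _ => c) s := by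
  rcases lt_or_ge t s with h | h
  · filter_upwards [mem_nhdsWithin_of_mem_nhds (lt_mem_nhds h)] with r hr
    rw [indicator_of_mem (mem_Ici.2 (le_of_lt hr)), indicator_of_mem (mem_Ioi.2 h)]
  · filter_upwards [self_mem_nhdsWithin] with r hr
    rw [indicator_of_notMem (notMem_Ici.2 (lt_of_lt_of_le hr h)),
      indicator_of_notMem (notMem_Ioi.2 h)]

/-- Integration by parts for piecewise smooth functions. -/
theorem integral_by_parts [CompleteSpace V] (D : PWDist V)
    (φ : 𝓓((⊤ : TopologicalSpace.Opens ℝ), ℝ)) :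
    ((∫ t, φ t • reg (deriv D) t) +
      ∑ᶠ t, φ t • (rightVal t D - leftVal t D)) = -∫ t, _root_.deriv φ t • reg D t := by
  classical
  set J : ℝ → V := fun t => rightVal t D - leftVal t D with hJ
  have hfin : (tsupport φ ∩ {t | J t ≠ 0}).Finite :=
    finite_of_locally (fun t => (D.isPWSmooth.eventually_jump t).mono fun _ hs hs' => hs' hs)
      φ.hasCompactSupport
  set T : Finset ℝ := hfin.toFinset with hT
  have hsum : ∑ᶠ t, φ t • J t = ∑ t ∈ T, φ t • J t := by
    apply finsum_eq_sum_of_support_subset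
    rw [hT, Set.Finite.coe_toFinset]
    intro t ht
    refine ⟨?_, fun h => ht ?_⟩
    · by_contra h
      exact ht (by simp [image_eq_zero_of_notMem_tsupport h])
    · simp [h]
  obtain ⟨a, b, hab, hK⟩ : ∃ a b : ℝ, a < b ∧ tsupport φ ⊆ Ioo a b := by
    obtain ⟨R, hR, hR'⟩ := φ.hasCompactSupport.isBounded.subset_ball_lt 0 0
    rw [Real.ball_eq_Ioo] at hR'
    exact ⟨0 - R, 0 + R, by linarith, hR'⟩
  have hφa : φ a = 0 := image_eq_zero_of_notMem_tsupport fun h => lt_irrefl _ (hK h).1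
  have hφb : φ b = 0 := image_eq_zero_of_notMem_tsupport fun h => lt_irrefl _ (hK h).2
  have hdφ : ∀ t, HasDerivAt φ (_root_.deriv φ t) t := fun t =>
    ((φ.contDiff.differentiable (by simp)) t).hasDerivAt
  set S : ℝ → V := fun s => ∑ t ∈ T, (Ici t).indicator (fun _ => φ t • J t) s with hS
  set F : ℝ → V := fun s => φ s • reg D s - S s with hF
  have hSr : ∀ s, S =ᶠ[𝓝[≥] s] fun _ => S s := by
    intro s
    have : ∀ᶠ r in 𝓝[≥] s, ∀ t ∈ T, (Ici t).indicator (fun _ => φ t • J t) r =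
        (Ici t).indicator (fun _ => φ t • J t) s :=
      (Finset.eventually_all T).2 fun t _ => eventually_const_indicator t s _
    filter_upwards [this] with r hr using Finset.sum_congr rfl hr
  have hSl : ∀ s, S =ᶠ[𝓝[<] s] fun _ => S s - φ s • J s := by
    intro s
    have : ∀ᶠ r in 𝓝[<] s, ∀ t ∈ T, (Ici t).indicator (fun _ => φ t • J t) r =
        (Ioi t).indicator (fun _ => φ t • J t) s :=
      (Finset.eventually_all T).2 fun t _ => eventually_const_indicator_left t s _
    have h2 : S s - φ s • J s = ∑ t ∈ T, (Ioi t).indicator (fun _ => φ t • J t) s := by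
      have h3 : φ s • J s = ∑ t ∈ T, if t = s then φ t • J t else 0 := by
        rw [Finset.sum_ite_eq' T s]
        split_ifs with h
        · rfl
        · rw [hT, Set.Finite.mem_toFinset] at h
          by_contra h'
          refine h ⟨?_, fun h0 => h' (by simp [h0])⟩
          by_contra h0
          exact h' (by simp [image_eq_zero_of_notMem_tsupport h0])
      rw [h3, hS, ← Finset.sum_sub_distrib]
      refine Finset.sum_congr rfl fun t _ => ?_
      rcases lt_trichotomy t s with h | h | h
      · simp [h, h.le, h.ne]
      · simp [h]
      · simp [h.ne', not_le.2 h, not_lt.2 h.le]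
    filter_upwards [this] with r hr
    rw [h2]
    exact Finset.sum_congr rfl hr
  have hder : ∀ s, HasDerivWithinAt F (φ s • reg (deriv D) s + _root_.deriv φ s • reg D s)
      (Ici s) s := by
    intro s
    have h1 := (hdφ s).hasDerivWithinAt.smul (D.isPWSmooth.hasDerivWithinAt s)
    have h2 : HasDerivWithinAt S 0 (Ici s) s :=
      (hasDerivWithinAt_const s (Ici s) (S s)).congr_of_eventuallyEq (hSr s) rfl
    have h3 := h1.sub h2
    rw [sub_zero] at h3
    exact h3
  have hcont : Continuous F := by
    rw [continuous_iff_continuousAt]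
    intro s
    rw [continuousAt_iff_continuous_left'_right']
    refine ⟨?_, (hder s).continuousWithinAt.mono Ioi_subset_Ici_self⟩
    have h1 : Tendsto (fun r => φ r • reg D r) (𝓝[<] s) (𝓝 (φ s • leftVal s D)) :=
      ((φ.continuous.tendsto s).mono_left nhdsWithin_le_nhds).smul (D.tendsto_leftVal s)
    have h2 : Tendsto S (𝓝[<] s) (𝓝 (S s - φ s • J s)) :=
      tendsto_const_nhds.congr' (hSl s).symm
    have h3 := h1.sub h2
    have h4 : φ s • leftVal s D - (S s - φ s • J s) = F s := by
      change _ = φ s • rightVal s D - S s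
      rw [hJ]
      simp only [smul_sub]
      abel
    rwa [h4] at h3
  have hint1 : Integrable fun t => φ t • reg (deriv D) t := integrable_smul_reg _ φ
  have hint2 : Integrable fun t => _root_.deriv φ t • reg D t := by
    have := integrable_smul_reg D (∂_{(1 : ℝ)} φ)
    rwa [coe_lineDeriv] at this
  have hFTC := intervalIntegral.integral_eq_sub_of_hasDeriv_right (a := a) (b := b)
    hcont.continuousOn (fun s _ => (hder s).mono Ioi_subset_Ici_self)
    (hint1.add hint2).intervalIntegrable
  have hsupp : Function.support (fun t => φ t • reg (deriv D) t + _root_.deriv φ t • reg D t) ⊆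
      Ioc a b := by
    intro t ht
    have : t ∈ tsupport φ := by
      by_contra h
      have h' : _root_.deriv φ t = 0 := by
        by_contra h''
        exact h (support_deriv_subset h'')
      exact ht (by simp [image_eq_zero_of_notMem_tsupport h, h'])
    exact Ioo_subset_Ioc_self (hK this)
  have hFa : F a = 0 := by
    simp only [hF, hφa, zero_smul, zero_sub, neg_eq_zero, hS]
    refine Finset.sum_eq_zero fun t ht => indicator_of_notMem ?_ _
    rw [hT, Set.Finite.mem_toFinset] at ht
    exact notMem_Ici.2 (hK ht.1).1
  have hFb : F b = -∑ t ∈ T, φ t • J t := by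
    simp only [hF, hφb, zero_smul, zero_sub, neg_inj, hS]
    refine Finset.sum_congr rfl fun t ht => indicator_of_mem ?_ _
    rw [hT, Set.Finite.mem_toFinset] at ht
    exact mem_Ici.2 (hK ht.1).2.le
  rw [intervalIntegral.integral_eq_integral_of_support_subset hsupp, hFa, hFb,
    integral_add hint1 hint2, sub_zero] at hFTC
  rw [hsum, eq_neg_iff_add_eq_zero, add_right_comm, hFTC]
  simp

/-- `PWDist.deriv` is the distributional derivative. -/
theorem toDistribution_deriv [CompleteSpace V] (D : PWDist V) :
    toDistribution (deriv D) = ∂_{(1 : ℝ)} (toDistribution D) := by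
  ext φ
  rw [Distribution.lineDerivOp_apply_apply, toDistribution_apply, toDistribution_apply]
  have h1 : ∀ t, impulse t φ (imp (deriv D) t) =
      φ t • (rightVal t D - leftVal t D) + impulse t (-∂_{(1 : ℝ)} φ) (imp D t) := by
    intro t
    change impulse t φ (Finsupp.single 0 (rightVal t D - leftVal t D) +
      (imp D t).mapDomain Nat.succ) = _
    rw [map_add]
    congr 1
    · rw [impulse_apply, Finsupp.sum_single_index (by simp)]
      rfl
    · rw [impulse_apply, impulse_apply, Finsupp.sum_mapDomain_index (by simp)
        (by simp [smul_add])]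
      simp only [Nat.succ_eq_add_one, diracDeriv_succ]
  have hfin : (Function.support fun t => φ t • (rightVal t D - leftVal t D)).Finite := by
    have : (tsupport φ ∩ {t | rightVal t D - leftVal t D ≠ 0}).Finite :=
      finite_of_locally (fun t => (D.isPWSmooth.eventually_jump t).mono fun _ hs hs' => hs' hs)
        φ.hasCompactSupport
    refine this.subset fun t ht => ⟨?_, fun h => ht ?_⟩
    · by_contra h
      exact ht (by simp [image_eq_zero_of_notMem_tsupport h])
    · simp [h]
  have h2 : ∀ t, (-∂_{(1 : ℝ)} φ : 𝓓((⊤ : TopologicalSpace.Opens ℝ), ℝ)) t =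
      -_root_.deriv φ t := by
    intro t
    rw [← coe_lineDeriv]; rfl
  simp only [h1, h2, neg_smul]
  rw [finsum_add_distrib hfin (finite_support_impulse D _), integral_neg, ← integral_by_parts]
  abel

theorem diracDeriv_apply (t : ℝ) (j : ℕ) (φ : 𝓓((⊤ : TopologicalSpace.Opens ℝ), ℝ)) :
    diracDeriv t j φ = (-1) ^ j * iteratedDeriv j φ t := by
  induction j generalizing φ with
  | zero => simp [diracDeriv]
  | succ j ih =>
    rw [diracDeriv_succ, map_neg, ih, coe_lineDeriv, iteratedDeriv_succ', pow_succ]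
    ring

theorem reg_eq_zero [CompleteSpace V] {D : PWDist V} (h : toDistribution D = 0) :
    reg D = 0 := by
  funext t
  obtain ⟨-, ⟨g, hg, hg'⟩⟩ := D.isPWSmooth t
  have h1 : ∀ᶠ s in 𝓝[>] t, reg D s = g s ∧ imp D s = 0 :=
    (hg'.filter_mono (nhdsWithin_mono _ Ioi_subset_Ici_self)).and
      ((D.eventually_imp t).filter_mono (nhdsWithin_mono _ fun s hs => ne_of_gt hs))
  obtain ⟨u, hu, hu'⟩ := mem_nhdsGT_iff_exists_Ioo_subset.1 h1
  have hz : ∀ᵐ x, x ∈ Ioo t u → g x = 0 := by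
    apply isOpen_Ioo.ae_eq_zero_of_integral_contDiff_smul_eq_zero
      (hg.continuous.locallyIntegrable.locallyIntegrableOn _)
    intro k hk hk' hk''
    have h2 := DFunLike.congr_fun h
      (⟨k, hk, hk', subset_univ _⟩ : 𝓓((⊤ : TopologicalSpace.Opens ℝ), ℝ))
    rw [toDistribution_apply] at h2
    have h3 : ∀ s, impulse s (⟨k, hk, hk', subset_univ _⟩ :
        𝓓((⊤ : TopologicalSpace.Opens ℝ), ℝ)) (imp D s) = 0 := by
      intro s
      by_cases hs : s ∈ tsupport k
      · rw [(hu' (hk'' hs)).2, map_zero]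
      · exact impulse_eq_zero hs _
    rw [finsum_eq_zero_of_forall_eq_zero h3, add_zero] at h2
    refine Eq.trans (integral_congr_ae (Eventually.of_forall fun s => ?_)) h2
    change k s • g s = k s • reg D s
    by_cases hs : s ∈ tsupport k
    · rw [(hu' (hk'' hs)).1]
    · rw [image_eq_zero_of_notMem_tsupport hs, zero_smul, zero_smul]
  have h4 : EqOn g 0 (Ioo t u) := by
    refine Measure.eqOn_open_of_ae_eq (μ := volume) ?_ isOpen_Ioo hg.continuous.continuousOn
      continuousOn_const
    rw [EventuallyEq, ae_restrict_iff' measurableSet_Ioo]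
    exact hz
  have h5 := h4.closure hg.continuous continuous_const
  rw [closure_Ioo (ne_of_lt hu)] at h5
  rw [hg'.self_of_nhdsWithin (mem_Ici.2 le_rfl)]
  exact h5 ⟨le_rfl, le_of_lt hu⟩

/-- A piecewise-smooth distribution determines its regular part and its impulses. -/
theorem toDistribution_injective [CompleteSpace V] :
    Function.Injective (toDistribution : PWDist V → _) := by
  rw [← LinearMap.ker_eq_bot, LinearMap.ker_eq_bot']
  intro D h
  have h0 := reg_eq_zero h
  refine PWDist.ext (by rw [h0, map_zero]) ?_
  rw [map_zero]
  funext t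
  ext j
  have hev := eventually_nhdsWithin_iff.1 (D.eventually_imp t)
  obtain ⟨b, hb, hb', hb'', -, hb1⟩ : ∃ b : ℝ → ℝ, tsupport b ⊆ {s | s ≠ t → imp D s = 0} ∧
      HasCompactSupport b ∧ ContDiff ℝ ∞ b ∧ True ∧ b =ᶠ[𝓝 t] 1 := by
    obtain ⟨ε, hε, hε'⟩ := Metric.eventually_nhds_iff_ball.1 hev
    let B : ContDiffBump t := ⟨ε / 3, ε / 2, by positivity, by linarith⟩
    refine ⟨B, ?_, B.hasCompactSupport, B.contDiff, trivial, B.eventuallyEq_one⟩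
    rw [B.tsupport_eq]
    intro s hs
    refine hε' s (Metric.closedBall_subset_ball ?_ hs)
    change ε / 2 < ε
    linarith
  have hk : ContDiff ℝ ∞ fun s => b s * (s - t) ^ j :=
    hb''.mul ((contDiff_id.sub contDiff_const).pow j)
  have hts : tsupport (fun s => b s * (s - t) ^ j) ⊆ tsupport b := tsupport_mul_subset_left
  have h2 := DFunLike.congr_fun h (⟨fun s => b s * (s - t) ^ j, hk, hb'.mul_right,
    subset_univ _⟩ : 𝓓((⊤ : TopologicalSpace.Opens ℝ), ℝ))
  rw [toDistribution_apply, h0] at h2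
  have h3 : ∀ s, s ≠ t → impulse s (⟨fun s => b s * (s - t) ^ j, hk, hb'.mul_right,
      subset_univ _⟩ : 𝓓((⊤ : TopologicalSpace.Opens ℝ), ℝ)) (imp D s) = 0 := by
    intro s hst
    by_cases hs : s ∈ tsupport fun s => b s * (s - t) ^ j
    · rw [hb (hts hs) hst, map_zero]
    · exact impulse_eq_zero hs _
  have h4 : ∀ i, diracDeriv t i (⟨fun s => b s * (s - t) ^ j, hk, hb'.mul_right,
      subset_univ _⟩ : 𝓓((⊤ : TopologicalSpace.Opens ℝ), ℝ)) =
      if i = j then (-1) ^ j * (j.factorial : ℝ) else 0 := by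
    intro i
    rw [diracDeriv_apply]
    change (-1) ^ i * iteratedDeriv i (fun s => b s * (s - t) ^ j) t = _
    have h5 : (fun s => b s * (s - t) ^ j) =ᶠ[𝓝 t] fun s => (s - t) ^ j := by
      filter_upwards [hb1] with s hs
      rw [hs, Pi.one_apply, one_mul]
    rw [h5.iteratedDeriv_eq, iteratedDeriv_comp_sub_const i (fun s : ℝ => s ^ j) t]
    simp only [sub_self]
    rw [iteratedDeriv_fun_pow_zero]
    split_ifs with hij
    · rw [hij]
    · rw [Nat.cast_zero, mul_zero]
  rw [finsum_eq_single _ t h3, impulse_apply] at h2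
  simp only [h4, ite_smul, zero_smul, Pi.zero_apply, smul_zero, integral_zero, zero_add,
    Finsupp.sum_ite_eq'] at h2
  by_contra hne
  rw [if_pos (Finsupp.mem_support_iff.2 hne)] at h2
  have h6 : ((-1 : ℝ) ^ j * (j.factorial : ℝ)) ≠ 0 :=
    mul_ne_zero (pow_ne_zero _ (by norm_num)) (Nat.cast_ne_zero.2 (Nat.factorial_ne_zero j))
  exact hne ((smul_eq_zero.1 h2).resolve_left h6)

end PWDist

end PWDist

/-! ### Switched differential-algebraic equations -/

/-- Multiplication by a matrix as a map of Euclidean spaces. -/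
def mulMat {a b : ℕ} (M : Matrix (Fin a) (Fin b) ℝ) :
    EuclideanSpace ℝ (Fin b) →L[ℝ] EuclideanSpace ℝ (Fin a) :=
  LinearMap.toContinuousLinearMap (Matrix.toEuclideanLin M)

/-- The column space `im M` of a matrix. -/
def colSpace {a : ℕ} {ι : Type*} [Fintype ι] [DecidableEq ι] (M : Matrix (Fin a) ι ℝ) :
    Submodule ℝ (EuclideanSpace ℝ (Fin a)) :=
  LinearMap.range (Matrix.toEuclideanLin M)

/-- The pair `(E, A)` is regular: `det (s E - A)` is not the zero polynomial. -/
def IsRegularPair {n : ℕ} (E A : Matrix (Fin n) (Fin n) ℝ) : Prop :=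
  ((Polynomial.X : Polynomial ℝ) • E.map Polynomial.C - A.map Polynomial.C).det ≠ 0

/-- The data of a switched DAE `E_σ x' = A_σ x + B_σ u`, `y = C_σ x + D_σ u` with `n` states, `m`
inputs and `l` outputs: mode `k` is active on `[t k, t (k + 1))`, where `0 = t 0 < t 1 < ⋯`. -/
structure SwitchedDAE (n m l : ℕ) where
  E : ℕ → Matrix (Fin n) (Fin n) ℝ
  A : ℕ → Matrix (Fin n) (Fin n) ℝ
  B : ℕ → Matrix (Fin n) (Fin m) ℝ
  C : ℕ → Matrix (Fin l) (Fin n) ℝ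
  D : ℕ → Matrix (Fin l) (Fin m) ℝ
  t : ℕ → ℝ
  t_zero : t 0 = 0
  t_strictMono : StrictMono t

/-- A class `𝒦ℒ` function `β(r, t)`. -/
structure IsClassKL (β : ℝ≥0 → ℝ≥0 → ℝ≥0) : Prop where
  continuous : ∀ t, Continuous fun r => β r t
  strictMono : ∀ t, StrictMono fun r => β r t
  zero : ∀ t, β 0 t = 0
  antitone : ∀ r, Antitone (β r)
  tendsto : ∀ r, Tendsto (β r) atTop (𝓝 0)

/-- A quasi-Weierstrass form `(S E T, S A T) = (diag(I, N), diag(J, I))`, with `N` nilpotent, of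
the pair `(E, A)`. -/
structure QuasiWeierstrass {n : ℕ} (E A : Matrix (Fin n) (Fin n) ℝ) where
  n₁ : ℕ
  n₂ : ℕ
  add_eq : n₁ + n₂ = n
  S : Matrix (Fin n) (Fin n) ℝ
  T : Matrix (Fin n) (Fin n) ℝ
  J : Matrix (Fin n₁) (Fin n₁) ℝ
  N : Matrix (Fin n₂) (Fin n₂) ℝ
  isUnit_S : IsUnit S
  isUnit_T : IsUnit T
  isNilpotent_N : IsNilpotent N
  E_eq : S * E * T = (Matrix.fromBlocks 1 0 0 N).reindex
    (finSumFinEquiv.trans (finCongr add_eq)) (finSumFinEquiv.trans (finCongr add_eq))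
  A_eq : S * A * T = (Matrix.fromBlocks J 0 0 1).reindex
    (finSumFinEquiv.trans (finCongr add_eq)) (finSumFinEquiv.trans (finCongr add_eq))

namespace QuasiWeierstrass

variable {n l : ℕ} {E A : Matrix (Fin n) (Fin n) ℝ} (Q : QuasiWeierstrass E A)

/-- The block diagonal matrix `T diag(X, Y) T⁻¹`. -/
def conj (X : Matrix (Fin Q.n₁) (Fin Q.n₁) ℝ) (Y : Matrix (Fin Q.n₂) (Fin Q.n₂) ℝ) :
    Matrix (Fin n) (Fin n) ℝ :=
  Q.T * (Matrix.fromBlocks X 0 0 Y).reindex (finSumFinEquiv.trans (finCongr Q.add_eq))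
    (finSumFinEquiv.trans (finCongr Q.add_eq)) * Q.T⁻¹

/-- The consistency projector `Π = T diag(I, 0) T⁻¹`. -/
def proj : Matrix (Fin n) (Fin n) ℝ := Q.conj 1 0

/-- `A^diff = T diag(J, 0) T⁻¹`. -/
def Adiff : Matrix (Fin n) (Fin n) ℝ := Q.conj Q.J 0

/-- `E^imp = T diag(0, N) T⁻¹`. -/
def Eimp : Matrix (Fin n) (Fin n) ℝ := Q.conj 0 Q.N

/-- `C^diff = C Π`. -/
def Cdiff (C : Matrix (Fin l) (Fin n) ℝ) : Matrix (Fin l) (Fin n) ℝ := C * Q.proj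

/-- `O^diff = [C^diff / C^diff A^diff / ⋯ / C^diff (A^diff)^(n-1)]`. -/
def Odiff (C : Matrix (Fin l) (Fin n) ℝ) : Matrix (Fin n × Fin l) (Fin n) ℝ :=
  Matrix.of fun i => (Q.Cdiff C * Q.Adiff ^ (i.1 : ℕ)) i.2

/-- `O^imp = [C E^imp / C (E^imp)^2 / ⋯ / C (E^imp)^(n-1)]`. -/
def Oimp (C : Matrix (Fin l) (Fin n) ℝ) : Matrix (Fin (n - 1) × Fin l) (Fin n) ℝ :=
  Matrix.of fun i => (C * Q.Eimp ^ ((i.1 : ℕ) + 1)) i.2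

end QuasiWeierstrass

namespace SwitchedDAE

variable {n m l : ℕ} (S : SwitchedDAE n m l)

/-- The length `τ_k` of the `k`-th switching interval. -/
def τ (k : ℕ) : ℝ := S.t (k + 1) - S.t k

/-- `(x, u, y)` solves the switched DAE on `[t_p, t_q)`: both equations, restricted to
`[t_p, t_q)`, hold as equations of piecewise-smooth distributions. As
`E_σ x' = ∑_k (E_k x')_{[t_k, t_{k+1})}`, and likewise for the other products, and as `[t_p, t_q)`
is the disjoint union of the `[t_k, t_{k+1})` with `p ≤ k < q`, this is stated mode by mode. -/
def IsSolution (p q : ℕ) (x : PWDist (EuclideanSpace ℝ (Fin n)))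
    (u : PWDist (EuclideanSpace ℝ (Fin m))) (y : PWDist (EuclideanSpace ℝ (Fin l))) : Prop :=
  ∀ k, p ≤ k → k < q →
    PWDist.restrict (S.t k) (S.t (k + 1)) (PWDist.map (mulMat (S.E k)) (PWDist.deriv x)) =
      PWDist.restrict (S.t k) (S.t (k + 1))
        (PWDist.map (mulMat (S.A k)) x + PWDist.map (mulMat (S.B k)) u) ∧
    PWDist.restrict (S.t k) (S.t (k + 1)) y =
      PWDist.restrict (S.t k) (S.t (k + 1))
        (PWDist.map (mulMat (S.C k)) x + PWDist.map (mulMat (S.D k)) u)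

/-- The switched DAE is `[t_p, t_q)`-detectable with `𝒦ℒ`-function `β`. -/
structure IsIntervalDetectable (p q : ℕ) (β : ℝ≥0 → ℝ≥0 → ℝ≥0) : Prop where
  isClassKL : IsClassKL β
  lt : ∀ r, 0 < r → β r (S.t q - S.t p).toNNReal < r
  le : ∀ x, S.IsSolution p q x 0 0 → ∀ t ∈ Ico (S.t p) (S.t q),
    ‖PWDist.rightVal t x‖₊ ≤ β ‖PWDist.leftVal (S.t p) x‖₊ (t - S.t p).toNNReal

/-- The `[t_k, t_q)`-unobservable space `𝒩_k^q` of all values `e(t_k⁻)` of solutions `e`, with zero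
output, of the homogeneous DAE `E_σ e' = A_σ e`, `y^e = C_σ e` on `[t_k, t_q)`. -/
def unobs (k q : ℕ) : Submodule ℝ (EuclideanSpace ℝ (Fin n)) where
  carrier := {e₀ | ∃ e, S.IsSolution k q e 0 0 ∧ PWDist.leftVal (S.t k) e = e₀}
  zero_mem' := ⟨0, fun _ _ _ => by simp, by simp⟩
  add_mem' := by
    rintro _ _ ⟨e, he, rfl⟩ ⟨f, hf, rfl⟩
    refine ⟨e + f, fun j hj hj' => ?_, by simp⟩
    have h1 := he j hj hj'
    have h2 := hf j hj hj'
    simp only [map_zero, add_zero] at h1 h2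
    simp only [map_zero, add_zero, map_add, h1.1, h2.1, ← h1.2, ← h2.2, and_self]
  smul_mem' := by
    rintro c _ ⟨e, he, rfl⟩
    refine ⟨c • e, fun j hj hj' => ?_, by simp⟩
    have h1 := he j hj hj'
    simp only [map_zero, add_zero] at h1
    simp only [map_zero, add_zero, map_smul, h1.1, ← h1.2, smul_zero, and_self]

/-- The local unobservable space `𝒲_k` of mode `k`. -/
def localUnobs (k : ℕ) : Submodule ℝ (EuclideanSpace ℝ (Fin n)) := S.unobs k (k + 1)

/-- The matrices (determined up to the choice of bases and of solutions of linear equations) from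
which the ideal estimation error correction on `[t_p, t_q)` is computed. -/
structure ObserverDesign (p q : ℕ) where
  /-- a quasi-Weierstrass form of every mode -/
  qwf : ∀ k, QuasiWeierstrass (S.E k) (S.A k)
  /-- numbers of columns -/
  dDiff : ℕ → ℕ
  dImp : ℕ → ℕ
  dZ : ℕ → ℕ
  dM : ℕ → ℕ
  dΘ : ℕ → ℕ
  /-- orthonormal `Z_k^diff` with `im Z_k^diff = im (O_k^diff)ᵀ` -/
  Zdiff : ∀ k, Matrix (Fin n) (Fin (dDiff k)) ℝ
  Zdiff_orth : ∀ k, p ≤ k → k < q → (Zdiff k).transpose * Zdiff k = 1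
  Zdiff_im : ∀ k, p ≤ k → k < q →
    colSpace (Zdiff k) = colSpace ((qwf k).Odiff (S.C k)).transpose
  /-- orthonormal `Z_k^imp` with `im Z_k^imp = im (O_k^imp)ᵀ` -/
  Zimp : ∀ k, Matrix (Fin n) (Fin (dImp k)) ℝ
  Zimp_orth : ∀ k, p ≤ k → k < q → (Zimp k).transpose * Zimp k = 1
  Zimp_im : ∀ k, p ≤ k → k < q →
    colSpace (Zimp k) = colSpace ((qwf k).Oimp (S.C k)).transpose
  /-- orthonormal `Z_k` with `im Z_k = 𝒲_kᗮ` -/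
  Z : ∀ k, Matrix (Fin n) (Fin (dZ k)) ℝ
  Z_orth : ∀ k, p ≤ k → k < q → (Z k).transpose * Z k = 1
  Z_im : ∀ k, p ≤ k → k < q → colSpace (Z k) = (S.localUnobs k)ᗮ
  /-- `U_k^imp` with `-(O_k^imp)ᵀ U_k^imp = Z_k^imp` -/
  Uimp : ∀ k, Matrix (Fin (n - 1) × Fin l) (Fin (dImp k)) ℝ
  Uimp_eq : ∀ k, p ≤ k → k < q → -((qwf k).Oimp (S.C k)).transpose * Uimp k = Zimp k
  /-- `U_k^obs` with `Z_k = [Π_kᵀ Z_k^diff, Z_k^imp] U_k^obs` -/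
  Uobs : ∀ k, Matrix (Fin (dDiff k) ⊕ Fin (dImp k)) (Fin (dZ k)) ℝ
  Uobs_eq : ∀ k, p ≤ k → k < q →
    Z k = Matrix.fromCols ((qwf k).proj.transpose * Zdiff k) (Zimp k) * Uobs k
  /-- orthonormal `M_k^q` with `im M_k^q = (𝒩_k^q)ᗮ`, and `M_{q-1}^q = Z_{q-1}` -/
  M : ∀ k, Matrix (Fin n) (Fin (dM k)) ℝ
  M_orth : ∀ k, p ≤ k → k < q → (M k).transpose * M k = 1
  M_im : ∀ k, p ≤ k → k < q → colSpace (M k) = (S.unobs k q)ᗮ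
  dM_last : ∀ k, k + 1 = q → dM k = dZ k
  M_last : ∀ k (h : k + 1 = q), M k = (Z k).submatrix id (Fin.cast (dM_last k h))
  /-- `Θ_k^q` with `im Θ_k^q = (e^{-A_k^diff τ_k} 𝒩_{k+1}^q)ᗮ` -/
  Θ : ∀ k, Matrix (Fin n) (Fin (dΘ k)) ℝ
  Θ_im : ∀ k, p ≤ k → k + 1 < q →
    colSpace (Θ k) = ((S.unobs (k + 1) q).map
      (Matrix.toEuclideanLin (NormedSpace.exp (-(S.τ k) • (qwf k).Adiff))))ᗮ
  /-- `U_k^q` with `M_k^q = [Z_k, Π_kᵀ Θ_k^q] U_k^q` -/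
  U : ∀ k, Matrix (Fin (dZ k) ⊕ Fin (dΘ k)) (Fin (dM k)) ℝ
  U_eq : ∀ k, p ≤ k → k + 1 < q →
    M k = Matrix.fromCols (Z k) ((qwf k).proj.transpose * Θ k) * U k

namespace ObserverDesign

variable {S} {p q : ℕ} (d : S.ObserverDesign p q)

/-- `S_k^diff = (Z_k^diff)ᵀ A_k^diff Z_k^diff`. -/
def Sdiff (k : ℕ) : Matrix (Fin (d.dDiff k)) (Fin (d.dDiff k)) ℝ :=
  (d.Zdiff k).transpose * (d.qwf k).Adiff * d.Zdiff k

/-- `R_k^diff = C_k^diff Z_k^diff`. -/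
def Rdiff (k : ℕ) : Matrix (Fin l) (Fin (d.dDiff k)) ℝ := (d.qwf k).Cdiff (S.C k) * d.Zdiff k

/-- `z` is a trajectory on `(t_k, t_{k+1})` of the observable ODE `z' = S_k^diff z` with output
`R_k^diff z` equal to `y`. -/
def IsDiffTrajectory (k : ℕ) (y : PWDist (EuclideanSpace ℝ (Fin l)))
    (z : ℝ → Fin (d.dDiff k) → ℝ) : Prop :=
  ∀ s ∈ Ioo (S.t k) (S.t (k + 1)),
    HasDerivAt z ((d.Sdiff k).mulVec (z s)) s ∧
      PWDist.reg y s = WithLp.toLp 2 ((d.Rdiff k).mulVec (z s))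

open Classical in
/-- The operator which recovers, from an output on `(t_k, t_{k+1})`, the trajectory of the
observable ODE `z' = S_k^diff z`, `y = R_k^diff z` producing it. -/
def diffObs (k : ℕ) (y : PWDist (EuclideanSpace ℝ (Fin l))) : ℝ → Fin (d.dDiff k) → ℝ :=
  if h : ∃ z, d.IsDiffTrajectory k y z then h.choose else 0

/-- `z_k^diff`, the value at `t_k⁺` of the recovered trajectory. -/
def zdiff (k : ℕ) (y : PWDist (EuclideanSpace ℝ (Fin l))) : Fin (d.dDiff k) → ℝ :=
  limUnder (𝓝[>] (S.t k)) (d.diffObs k y)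

/-- `z_k^imp = (U_k^imp)ᵀ η_k`, where `η_k` stacks the coefficients `η_k^0, …, η_k^{n-2}` of the
impulse `y[t_k] = ∑ j, η_k^j δ_{t_k}^{(j)}`. -/
def zimp (k : ℕ) (y : PWDist (EuclideanSpace ℝ (Fin l))) : Fin (d.dImp k) → ℝ :=
  (d.Uimp k).transpose.mulVec fun i => PWDist.imp y (S.t k) (i.1 : ℕ) i.2

/-- The ideal local observability operator `𝔒_k`. -/
def localObs (k : ℕ) (y : PWDist (EuclideanSpace ℝ (Fin l))) : Fin (d.dZ k) → ℝ :=
  (d.Uobs k).transpose.mulVec (Sum.elim (d.zdiff k y) (d.zimp k y))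

/-- The local observable components `z_k = 𝔒_k(y_{[t_k, t_{k+1})})` of an output mismatch. -/
def z (y : PWDist (EuclideanSpace ℝ (Fin l))) (k : ℕ) : Fin (d.dZ k) → ℝ :=
  d.localObs k (PWDist.restrict (S.t k) (S.t (k + 1)) y)

/-- `ℱ_k^q = (U_k^q)ᵀ diag(I, (Θ_k^q)ᵀ e^{-A_k^diff τ_k} M_{k+1}^q)`. -/
def F (k : ℕ) : Matrix (Fin (d.dM k)) (Fin (d.dZ k) ⊕ Fin (d.dM (k + 1))) ℝ :=
  (d.U k).transpose * Matrix.fromBlocks 1 0 0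
    ((d.Θ k).transpose * NormedSpace.exp (-(S.τ k) • (d.qwf k).Adiff) * d.M (k + 1))

/-- The backward recursion `μ_{q-1} = z_{q-1}`, `μ_k = ℱ_k^q (z_k / μ_{k+1})`. -/
def mu (z : ∀ k, Fin (d.dZ k) → ℝ) (k : ℕ) : Fin (d.dM k) → ℝ :=
  if h : k + 1 = q then fun i => z k (Fin.cast (d.dM_last k h) i)
  else if k + 1 < q then (d.F k).mulVec (Sum.elim (z k) (mu z (k + 1)))
  else 0
termination_by q - k

/-- The operator `𝒪_p^{q-1}`, which sends `(z_p / ⋯ / z_{q-1})` to `ξ^left = M_p^q μ_p`. -/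
def combine (z : ∀ k, Fin (d.dZ k) → ℝ) : EuclideanSpace ℝ (Fin n) :=
  WithLp.toLp 2 ((d.M p).mulVec (d.mu z p))

/-- The transition matrices `Φ_p^{p+j}`: `Φ_p^p = I` and
`Φ_p^{k+1} = e^{A_k^diff τ_k} Π_k Φ_p^k`. -/
def Phi : ℕ → Matrix (Fin n) (Fin n) ℝ
  | 0 => 1
  | j + 1 => NormedSpace.exp (S.τ (p + j) • (d.qwf (p + j)).Adiff) * (d.qwf (p + j)).proj * Phi j

/-- The correction `ξ^left = 𝒪_p^{q-1} (z_p / ⋯ / z_{q-1})` at the left end of the interval. -/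
def ξleft (ye : PWDist (EuclideanSpace ℝ (Fin l))) : EuclideanSpace ℝ (Fin n) :=
  d.combine (d.z ye)

/-- The ideal estimation error correction `ξ = Φ_p^q ξ^left`. -/
def ξ (ye : PWDist (EuclideanSpace ℝ (Fin l))) : EuclideanSpace ℝ (Fin n) :=
  mulMat (d.Phi (q - p)) (d.ξleft ye)

end ObserverDesign

end SwitchedDAE

end

/-! ### Matrices as maps of Euclidean spaces -/

section MatrixLemmas

variable {a b c : ℕ}

/-! The error `e = xhat - x` solves the homogeneous switched DAE with output `y^e`, the input having
cancelled. A quasi-Weierstrass form solves each mode explicitly in terms of `e(t_k⁻)` alone: on the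
mode interval `e(t) = exp((t - t_k) A^diff) Π e(t_k⁻)`, and the coefficient of `δ^{(j)}` at `t_k` is
`-(E^imp)^(j+1) e(t_k⁻)` (`IsModeSolution.reg_eq`, `IsModeSolution.imp_eq`). So the output on the
open interval reveals the observable coordinates of `Π e(t_k⁻)`, the output impulse at `t_k` reveals
`O^imp e(t_k⁻)`, and together they yield `Z_kᵀ e(t_k⁻)` (`z_eq`).

These local data are combined backwards in time. If `M_{k+1} μ_{k+1}` is the projection of
`e(t_{k+1}⁻)` onto the complement of `𝒩_{k+1}`, the part that is lost lies in `𝒩_{k+1}`. After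
multiplication by `exp(-A^diff τ_k)` it is annihilated by `Θ_kᵀ`, so `Θ_kᵀ Π e(t_k⁻)` is known
exactly. Joined with `z_k` this gives `M_kᵀ e(t_k⁻)` (`mu_eq`). At `k = p` the result is `ξ^left = M
Mᵀ e(t_p⁻)`, an orthogonal projection.

The remainder `e(t_p⁻) - ξ^left` therefore starts a solution with zero output. The matrix `Φ`
transports the left limits of every homogeneous solution to `t_q`, so the corrected error at `t_q⁻`
is the left limit there of this zero-output solution. Detectability bounds it by `β` of the size of
the remainder, which by Pythagoras is at most `|e(t_p⁻)|`. The detectability estimate holds only for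
`t < t_q`, and left continuity of `β` carries it to `t_q⁻`.

The matrices of the construction exist because each defining equation is an inclusion of column
spaces. On orthogonal complements it becomes the claim that certain vectors are unobservable. This
is shown by exhibiting solutions (`mem_localUnobs`) and by gluing them (`mem_unobs`). -/

theorem ofLp_mulMat (M : Matrix (Fin a) (Fin b) ℝ) (v : EuclideanSpace ℝ (Fin b)) :
    (mulMat M v).ofLp = M.mulVec v.ofLp := rfl

theorem mulMat_mul (M : Matrix (Fin a) (Fin b) ℝ) (N : Matrix (Fin b) (Fin c) ℝ)
    (v : EuclideanSpace ℝ (Fin c)) : mulMat (M * N) v = mulMat M (mulMat N v) := by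
  apply WithLp.ofLp_injective
  simp [ofLp_mulMat, Matrix.mulVec_mulVec]

theorem mulMat_one (v : EuclideanSpace ℝ (Fin a)) :
    mulMat (1 : Matrix (Fin a) (Fin a) ℝ) v = v := by
  apply WithLp.ofLp_injective
  simp [ofLp_mulMat]

theorem mulMat_zero (v : EuclideanSpace ℝ (Fin b)) :
    mulMat (0 : Matrix (Fin a) (Fin b) ℝ) v = 0 := by
  apply WithLp.ofLp_injective
  simp [ofLp_mulMat]

theorem mulMat_add (M N : Matrix (Fin a) (Fin b) ℝ) (v : EuclideanSpace ℝ (Fin b)) :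
    mulMat (M + N) v = mulMat M v + mulMat N v := by
  apply WithLp.ofLp_injective
  simp [ofLp_mulMat, Matrix.add_mulVec]

theorem mulMat_sub (M N : Matrix (Fin a) (Fin b) ℝ) (v : EuclideanSpace ℝ (Fin b)) :
    mulMat (M - N) v = mulMat M v - mulMat N v := by
  apply WithLp.ofLp_injective
  simp [ofLp_mulMat, Matrix.sub_mulVec]

theorem mulMat_injective_of_isUnit {M : Matrix (Fin a) (Fin a) ℝ} (hM : IsUnit M) :
    Function.Injective (mulMat M) := by
  intro v w h
  have hd := (Matrix.isUnit_iff_isUnit_det _).1 hM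
  have := congrArg (mulMat M⁻¹) h
  rwa [← mulMat_mul, ← mulMat_mul, Matrix.nonsing_inv_mul _ hd, mulMat_one, mulMat_one] at this

theorem fromCols_transpose_mulVec_eq_zero {ι κ : Type*} {M : Matrix (Fin a) ι ℝ}
    {N : Matrix (Fin a) κ ℝ} {v : Fin a → ℝ} (h : (Matrix.fromCols M N).transpose.mulVec v = 0) :
    M.transpose.mulVec v = 0 ∧ N.transpose.mulVec v = 0 := by
  rw [Matrix.transpose_fromCols, Matrix.fromRows_mulVec] at h
  exact ⟨funext fun i => congrFun h (Sum.inl i), funext fun i => congrFun h (Sum.inr i)⟩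

variable {ι κ : Type*} [Fintype ι] [DecidableEq ι] [Fintype κ] [DecidableEq κ]

theorem mem_colSpace {M : Matrix (Fin a) ι ℝ} {v : EuclideanSpace ℝ (Fin a)} :
    v ∈ colSpace M ↔ ∃ w : ι → ℝ, M.mulVec w = v.ofLp := by
  constructor
  · rintro ⟨w, rfl⟩
    exact ⟨w.ofLp, rfl⟩
  · rintro ⟨w, hw⟩
    exact ⟨WithLp.toLp 2 w, WithLp.ofLp_injective _ hw⟩

theorem mem_colSpace_orthogonal {M : Matrix (Fin a) ι ℝ} {v : EuclideanSpace ℝ (Fin a)} :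
    v ∈ (colSpace M)ᗮ ↔ M.transpose.mulVec v.ofLp = 0 := by
  have key : ∀ w : EuclideanSpace ℝ ι, inner ℝ (Matrix.toEuclideanLin M w) v =
      M.transpose.mulVec v.ofLp ⬝ᵥ w.ofLp := by
    intro w
    rw [EuclideanSpace.inner_eq_star_dotProduct, star_trivial,
      show (Matrix.toEuclideanLin M w).ofLp = M.mulVec w.ofLp from rfl,
      Matrix.dotProduct_mulVec, Matrix.mulVec_transpose]
  rw [Submodule.mem_orthogonal]
  constructor
  · intro h
    -- Testing orthogonality against the vector `M (Mᵀ v)` of the column space gives `|Mᵀ v|² = 0`.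
    refine dotProduct_self_eq_zero.1 ?_
    have := key (WithLp.toLp 2 (M.transpose.mulVec v.ofLp))
    rw [h _ ⟨_, rfl⟩] at this
    exact this.symm
  · rintro h _ ⟨w, rfl⟩
    rw [key, h, zero_dotProduct]

theorem exists_mul_eq_of_colSpace_le {M : Matrix (Fin a) ι ℝ} {N : Matrix (Fin a) κ ℝ}
    (h : colSpace M ≤ colSpace N) : ∃ U : Matrix κ ι ℝ, N * U = M := by
  have h1 : ∀ i, ∃ w : κ → ℝ, N.mulVec w = M.col i := by
    intro i
    have : (WithLp.toLp 2 (M.col i) : EuclideanSpace ℝ (Fin a)) ∈ colSpace M :=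
      mem_colSpace.2 ⟨Pi.single i 1, by simp⟩
    exact mem_colSpace.1 (h this)
  choose w hw using h1
  refine ⟨Matrix.of fun j i => w i j, ?_⟩
  ext r i
  exact congrFun (hw i) r

/-- In finite dimension the double orthogonal complement gives the subspace back. Existence of
coefficient matrices is thereby reduced to statements about kernels of transposes. -/
theorem colSpace_le_of_orthogonal_le {M : Matrix (Fin a) ι ℝ}
    {W : Submodule ℝ (EuclideanSpace ℝ (Fin a))} (h : (colSpace M)ᗮ ≤ W) : Wᗮ ≤ colSpace M := by
  have := Submodule.orthogonal_le h
  rwa [Submodule.orthogonal_orthogonal] at this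

theorem exists_orthonormal_colSpace_eq (W : Submodule ℝ (EuclideanSpace ℝ (Fin a))) :
    ∃ M : Matrix (Fin a) (Fin (Module.finrank ℝ W)) ℝ, M.transpose * M = 1 ∧ colSpace M = W := by
  let e := stdOrthonormalBasis ℝ W
  refine ⟨Matrix.of fun i j => (e j : EuclideanSpace ℝ (Fin a)) i, ?_, ?_⟩
  · ext i j
    have h := orthonormal_iff_ite.1 e.orthonormal j i
    rw [Submodule.coe_inner, EuclideanSpace.inner_eq_star_dotProduct, star_trivial] at h
    rw [Matrix.mul_apply, Matrix.one_apply]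
    simp only [eq_comm (a := i)]
    rw [← h]
    rfl
  · have h2 : ∀ w : Fin (Module.finrank ℝ W) → ℝ,
        (Matrix.of fun i j => (e j : EuclideanSpace ℝ (Fin a)) i).mulVec w =
          ((∑ j, w j • e j : W) : EuclideanSpace ℝ (Fin a)).ofLp := by
      intro w
      ext i
      simp [Matrix.mulVec, dotProduct, mul_comm]
    ext v
    rw [mem_colSpace]
    constructor
    · rintro ⟨w, hw⟩
      rw [h2] at hw
      rw [← WithLp.ofLp_injective _ hw]
      exact Submodule.coe_mem _
    · intro hv
      refine ⟨fun j => e.repr ⟨v, hv⟩ j, ?_⟩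
      rw [h2, e.sum_repr]

/-- For orthonormal columns `Mᵀ M Mᵀ = Mᵀ`, so `M Mᵀ` is the orthogonal projection onto the column
space. -/
theorem sub_mul_transpose_mem {M : Matrix (Fin a) (Fin b) ℝ} (hM : M.transpose * M = 1)
    (v : EuclideanSpace ℝ (Fin a)) :
    v - mulMat M (mulMat M.transpose v) ∈ (colSpace M)ᗮ := by
  rw [mem_colSpace_orthogonal, ← ofLp_mulMat, map_sub, ← mulMat_mul, hM, mulMat_one, sub_self]
  rfl

/-- The characteristic polynomial of a nilpotent matrix over a reduced ring is a power of `X`;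
Cayley–Hamilton then bounds the index of nilpotency by the size. -/
theorem IsNilpotent.matrix_pow_eq_zero {M : Matrix (Fin a) (Fin a) ℝ} (hM : IsNilpotent M) {k : ℕ}
    (hk : a ≤ k) : M ^ k = 0 := by
  have h := M.aeval_self_charpoly
  rw [sub_eq_zero.1 (Matrix.isNilpotent_charpoly_sub_pow_of_isNilpotent hM).eq_zero] at h
  rw [map_pow, Polynomial.aeval_X, Fintype.card_fin] at h
  exact pow_eq_zero_of_le hk h

/-- The common kernel of `C, C A, …, C A^(n-1)` is contained in the kernel of every `C A^k`. -/
theorem mulMat_mul_pow_eq_zero {C : Matrix (Fin b) (Fin a) ℝ} {M : Matrix (Fin a) (Fin a) ℝ}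
    {v : EuclideanSpace ℝ (Fin a)} (h : ∀ i < a, mulMat (C * M ^ i) v = 0) (k : ℕ) :
    mulMat (C * M ^ k) v = 0 := by
  -- Cayley–Hamilton: `M ^ k` is the value at `M` of the remainder of `X ^ k` modulo the
  -- characteristic polynomial.
  obtain ⟨f, hf⟩ : ∃ f : Fin a → ℝ, M ^ k = ∑ i : Fin a, f i • M ^ (i : ℕ) := by
    have h1 := Matrix.pow_eq_aeval_mod_charpoly M k
    -- For `a = 0` the characteristic polynomial is `1` and the strict degree bound used below
    -- fails.
    rcases Nat.eq_zero_or_pos a with rfl | ha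
    · exact ⟨0, Subsingleton.elim _ _⟩
    refine ⟨fun i => (Polynomial.X ^ k %ₘ M.charpoly).coeff i, ?_⟩
    rw [h1, Polynomial.aeval_eq_sum_range' (n := a), Finset.sum_range]
    have : M.charpoly ≠ 1 := fun hc => by
      have := M.charpoly_natDegree_eq_dim
      simp [hc] at this
      omega
    have h2 := Polynomial.natDegree_modByMonic_lt (Polynomial.X ^ k) M.charpoly_monic this
    rwa [M.charpoly_natDegree_eq_dim, Fintype.card_fin] at h2
  rw [hf, mulMat_mul]
  have h3 : mulMat (∑ i : Fin a, f i • M ^ (i : ℕ)) v =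
      ∑ i : Fin a, f i • mulMat (M ^ (i : ℕ)) v := by
    apply WithLp.ofLp_injective
    simp [ofLp_mulMat, Matrix.sum_mulVec, Matrix.smul_mulVec]
  rw [h3, map_sum]
  refine Finset.sum_eq_zero fun i _ => ?_
  rw [map_smul, ← mulMat_mul, h i i.2, smul_zero]

/-! ### The matrix exponential -/

theorem hasDerivAt_mulMat_exp (M : Matrix (Fin a) (Fin a) ℝ) (v : EuclideanSpace ℝ (Fin a))
    (t s : ℝ) :
    HasDerivAt (fun r => mulMat (NormedSpace.exp ((r - t) • M)) v)
      (mulMat M (mulMat (NormedSpace.exp ((s - t) • M)) v)) s := by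
  -- The norm on matrices is auxiliary: it gives access to the derivative of the exponential, and
  -- the statement does not depend on it.
  let _ : NormedRing (Matrix (Fin a) (Fin a) ℝ) := Matrix.linftyOpNormedRing
  let _ : NormedAlgebra ℝ (Matrix (Fin a) (Fin a) ℝ) := Matrix.linftyOpNormedAlgebra
  let L : Matrix (Fin a) (Fin a) ℝ →ₗ[ℝ] EuclideanSpace ℝ (Fin a) :=
    { toFun := fun X => mulMat X v
      map_add' := fun X Y => mulMat_add X Y v
      map_smul' := fun r X => by
        apply WithLp.ofLp_injective
        simp [ofLp_mulMat, Matrix.smul_mulVec] }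
  have h1 := (hasDerivAt_exp_smul_const' M (s - t)).comp_sub_const s t
  have h2 := (LinearMap.toContinuousLinearMap L).hasFDerivAt.comp_hasDerivAt s h1
  rw [← mulMat_mul]
  exact h2

/-- Bootstrapping: the derivative is `M` applied to the same function, so each order of smoothness
gives the next. -/
theorem contDiff_mulMat_exp (M : Matrix (Fin a) (Fin a) ℝ) (v : EuclideanSpace ℝ (Fin a)) (t : ℝ) :
    ContDiff ℝ ∞ (fun r => mulMat (NormedSpace.exp ((r - t) • M)) v) := by
  rw [contDiff_infty]
  intro n
  induction n with
  | zero =>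
    refine contDiff_zero.2 ?_
    exact continuous_iff_continuousAt.2 fun s => (hasDerivAt_mulMat_exp M v t s).continuousAt
  | succ n ih =>
    refine (contDiff_succ_iff_deriv (n := n)).2
      ⟨fun s => (hasDerivAt_mulMat_exp M v t s).differentiableAt,
      by simp, ?_⟩
    have : deriv (fun r => mulMat (NormedSpace.exp ((r - t) • M)) v) =
        fun r => mulMat M (mulMat (NormedSpace.exp ((r - t) • M)) v) :=
      funext fun s => (hasDerivAt_mulMat_exp M v t s).deriv
    rw [this]
    exact (mulMat M).contDiff.comp ih

theorem exp_zero_smul_matrix (M : Matrix (Fin a) (Fin a) ℝ) :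
    NormedSpace.exp ((0 : ℝ) • M) = 1 := by
  rw [zero_smul, NormedSpace.exp_zero]

theorem exp_neg_smul_mul_exp_smul (M : Matrix (Fin a) (Fin a) ℝ) (s : ℝ) :
    NormedSpace.exp (-s • M) * NormedSpace.exp (s • M) = 1 := by
  rw [← Matrix.exp_add_of_commute, ← add_smul, neg_add_cancel, exp_zero_smul_matrix]
  exact ((Commute.refl M).smul_left _).smul_right _

theorem exp_smul_mul_exp_neg_smul (M : Matrix (Fin a) (Fin a) ℝ) (s : ℝ) :
    NormedSpace.exp (s • M) * NormedSpace.exp (-s • M) = 1 := by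
  have := exp_neg_smul_mul_exp_smul M (-s)
  rwa [neg_neg] at this

theorem commute_exp_smul {M N : Matrix (Fin a) (Fin a) ℝ} (h : Commute N M) (s : ℝ) :
    Commute N (NormedSpace.exp (s • M)) := by
  let _ : NormedRing (Matrix (Fin a) (Fin a) ℝ) := Matrix.linftyOpNormedRing
  let _ : NormedAlgebra ℝ (Matrix (Fin a) (Fin a) ℝ) := Matrix.linftyOpNormedAlgebra
  let _ : NormedAlgebra ℚ (Matrix (Fin a) (Fin a) ℝ) := NormedAlgebra.restrictScalars ℚ ℝ _
  exact (h.smul_right s).exp_right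

end MatrixLemmas

/-! ### The quasi-Weierstrass form -/

section QuasiWeierstrassForm

theorem reindex_fromBlocks_mul {n n₁ n₂ : ℕ} (σ : Fin n₁ ⊕ Fin n₂ ≃ Fin n)
    (X X' : Matrix (Fin n₁) (Fin n₁) ℝ) (Y Y' : Matrix (Fin n₂) (Fin n₂) ℝ) :
    (Matrix.fromBlocks X 0 0 Y).reindex σ σ * (Matrix.fromBlocks X' 0 0 Y').reindex σ σ =
      (Matrix.fromBlocks (X * X') 0 0 (Y * Y')).reindex σ σ := by
  simp [Matrix.reindex_apply, Matrix.submatrix_mul_equiv, Matrix.fromBlocks_multiply]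

theorem reindex_fromBlocks_one {n n₁ n₂ : ℕ} (σ : Fin n₁ ⊕ Fin n₂ ≃ Fin n) :
    (Matrix.fromBlocks (1 : Matrix (Fin n₁) (Fin n₁) ℝ) 0 0
      (1 : Matrix (Fin n₂) (Fin n₂) ℝ)).reindex σ σ = 1 := by
  simp [Matrix.reindex_apply]

theorem reindex_fromBlocks_add {n n₁ n₂ : ℕ} (σ : Fin n₁ ⊕ Fin n₂ ≃ Fin n)
    (X X' : Matrix (Fin n₁) (Fin n₁) ℝ) (Y Y' : Matrix (Fin n₂) (Fin n₂) ℝ) :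
    (Matrix.fromBlocks X 0 0 Y).reindex σ σ + (Matrix.fromBlocks X' 0 0 Y').reindex σ σ =
      (Matrix.fromBlocks (X + X') 0 0 (Y + Y')).reindex σ σ := by
  rw [← add_zero (0 : Matrix (Fin n₁) (Fin n₂) ℝ), ← add_zero (0 : Matrix (Fin n₂) (Fin n₁) ℝ),
    ← Matrix.fromBlocks_add]
  simp [Matrix.reindex_apply, Matrix.submatrix_add]

/-- The Fitting decomposition of a real matrix. -/
theorem exists_fitting_decomposition {n : ℕ} (K : Matrix (Fin n) (Fin n) ℝ) :
    ∃ (n₁ n₂ : ℕ) (h : n₁ + n₂ = n) (T : Matrix (Fin n) (Fin n) ℝ)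
      (K₁ : Matrix (Fin n₁) (Fin n₁) ℝ) (K₂ : Matrix (Fin n₂) (Fin n₂) ℝ),
      IsUnit T ∧ IsUnit K₁ ∧ IsNilpotent K₂ ∧
      K * T = T * (Matrix.fromBlocks K₁ 0 0 K₂).reindex (finSumFinEquiv.trans (finCongr h))
        (finSumFinEquiv.trans (finCongr h)) := by
  set f : Module.End ℝ (Fin n → ℝ) := Matrix.toLin' K with hf
  -- For large `k` the kernel and range of `f ^ k` are complementary. The condition `1 ≤ k` gives
  -- `ker f ≤ ker (f ^ k)`, which makes `f` injective on the range.
  obtain ⟨k, hk, hk1⟩ := (f.eventually_isCompl_ker_pow_range_pow.and (eventually_ge_atTop 1)).exists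
  set R := LinearMap.range (f ^ k)
  set N := LinearMap.ker (f ^ k)
  have hR : ∀ x ∈ R, f x ∈ R := by
    rintro _ ⟨x, rfl⟩
    exact ⟨f x, by rw [← Module.End.mul_apply, ← Module.End.mul_apply, ← pow_succ, ← pow_succ']⟩
  have hN : ∀ x ∈ N, f x ∈ N := by
    intro x hx
    rw [LinearMap.mem_ker] at hx ⊢
    rw [← Module.End.mul_apply, ← pow_succ, pow_succ', Module.End.mul_apply, hx, map_zero]
  have h : Module.finrank ℝ R + Module.finrank ℝ N = n := by
    rw [Submodule.finrank_add_eq_of_isCompl hk.symm, Module.finrank_fin_fun]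
  let bR := Module.finBasis ℝ R
  let bN := Module.finBasis ℝ N
  let e := Submodule.prodEquivOfIsCompl R N hk.symm
  let σ := finSumFinEquiv.trans (finCongr h)
  let b := ((bR.prod bN).map e).reindex σ
  let s := Pi.basisFun ℝ (Fin n)
  refine ⟨_, _, h, s.toMatrix b, LinearMap.toMatrix bR bR (f.restrict hR),
    LinearMap.toMatrix bN bN (f.restrict hN), ?_, ?_, ?_, ?_⟩
  · exact ⟨⟨_, _, s.toMatrix_mul_toMatrix_flip b, b.toMatrix_mul_toMatrix_flip s⟩, rfl⟩
  · have hinj : LinearMap.ker (f.restrict hR) = ⊥ := by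
      rw [LinearMap.ker_eq_bot']
      intro x hx
      have h1 : f x = 0 := congrArg Subtype.val hx
      have h2 : (x : Fin n → ℝ) ∈ N := by
        rw [LinearMap.mem_ker]
        obtain ⟨j, rfl⟩ := Nat.exists_eq_add_of_le' hk1
        rw [pow_succ, Module.End.mul_apply, h1, map_zero]
      exact Subtype.ext (Submodule.disjoint_def.1 hk.disjoint _ h2 x.2)
    have hu : IsUnit (f.restrict hR) := (LinearMap.isUnit_iff_ker_eq_bot _).2 hinj
    exact hu.map (LinearMap.toMatrixAlgEquiv bR)
  · have hn : IsNilpotent (f.restrict hN) := by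
      refine ⟨k, ?_⟩
      ext x : 1
      rw [Module.End.pow_restrict]
      exact Subtype.ext x.2
    exact hn.map (LinearMap.toMatrixAlgEquiv bN)
  · have h1 : LinearMap.toMatrix b b f = (Matrix.fromBlocks
        (LinearMap.toMatrix bR bR (f.restrict hR)) 0 0
        (LinearMap.toMatrix bN bN (f.restrict hN))).reindex σ σ := by
      rw [← LinearMap.toMatrix_prodMap]
      have h2 : ∀ x, e.symm (f (e x)) = (f.restrict hR).prodMap (f.restrict hN) x := by
        intro x
        rw [LinearEquiv.symm_apply_eq]
        simp [e, Submodule.coe_prodEquivOfIsCompl']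
      ext i j
      simp only [LinearMap.toMatrix_apply, b, Matrix.reindex_apply, Matrix.submatrix_apply,
        Module.Basis.repr_reindex, Module.Basis.reindex_apply, Module.Basis.map_repr,
        Module.Basis.map_apply, LinearEquiv.trans_apply, h2, Finsupp.mapDomain_equiv_apply]
    -- Both sides of `K T = T [f]_b` are the matrix of `f` from the adapted basis `b` to the
    -- standard basis `s`.
    rw [← h1, basis_toMatrix_mul_linearMap_toMatrix]
    have h3 : K = LinearMap.toMatrix s s f := by
      rw [LinearMap.toMatrix_eq_toMatrix', hf, LinearMap.toMatrix'_toLin']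
    conv_lhs => rw [h3]
    rw [linearMap_toMatrix_mul_basis_toMatrix]

/-- Choose `c` with `G = c E - A` invertible. Since `G⁻¹ A = c G⁻¹ E - 1`, the Fitting basis of `G⁻¹
E` block-diagonalises both matrices, into `diag(K₁, K₂)` and `diag(c K₁ - 1, c K₂ - 1)`. Here `K₁`
is invertible and, as `K₂` is nilpotent, so is `c K₂ - 1`; scaling the blocks by these inverses
produces the two identity blocks. -/
theorem IsRegularPair.nonempty_quasiWeierstrass {n : ℕ} {E A : Matrix (Fin n) (Fin n) ℝ}
    (h : IsRegularPair E A) : Nonempty (QuasiWeierstrass E A) := by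
  -- A polynomial vanishing at every real number is zero, contrary to regularity.
  obtain ⟨c, hc⟩ : ∃ c : ℝ, (c • E - A).det ≠ 0 := by
    by_contra! hc
    refine h (Polynomial.funext fun c => ?_)
    rw [Polynomial.eval_zero, ← hc c, ← Polynomial.coe_evalRingHom, RingHom.map_det]
    congr 1
    ext i j
    simp
    exact mul_comm _ _
  set G := c • E - A with hG
  have hGu : IsUnit G.det := isUnit_iff_ne_zero.2 hc
  obtain ⟨n₁, n₂, hn, T, K₁, K₂, hT, hK₁, hK₂, hK⟩ := exists_fitting_decomposition (G⁻¹ * E)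
  set σ := finSumFinEquiv.trans (finCongr hn)
  have hTd := (Matrix.isUnit_iff_isUnit_det _).1 hT
  have hK₁d := (Matrix.isUnit_iff_isUnit_det _).1 hK₁
  have hV : IsUnit (c • K₂ - 1) := (hK₂.smul c).isUnit_sub_one
  have hVd := (Matrix.isUnit_iff_isUnit_det _).1 hV
  have hE : T⁻¹ * (G⁻¹ * E) * T = (Matrix.fromBlocks K₁ 0 0 K₂).reindex σ σ := by
    rw [Matrix.mul_assoc, hK, ← Matrix.mul_assoc, Matrix.nonsing_inv_mul _ hTd, Matrix.one_mul]
  have hA : T⁻¹ * (G⁻¹ * A) * T =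
      (Matrix.fromBlocks (c • K₁ - 1) 0 0 (c • K₂ - 1)).reindex σ σ := by
    have h1 : G⁻¹ * A = c • (G⁻¹ * E) - 1 := by
      rw [← Matrix.nonsing_inv_mul _ hGu, ← Matrix.mul_smul, ← Matrix.mul_sub, hG, sub_sub_cancel]
    have h2 := reindex_fromBlocks_add σ (c • K₁ - 1) 1 (c • K₂ - 1) 1
    rw [sub_add_cancel, sub_add_cancel, reindex_fromBlocks_one] at h2
    rw [eq_sub_of_add_eq h2, h1, Matrix.mul_sub, Matrix.sub_mul, Matrix.mul_one,
      Matrix.nonsing_inv_mul _ hTd, Matrix.mul_smul, Matrix.smul_mul, hE]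
    congr 1
    ext i j
    rcases hi : σ.symm i with i' | i' <;> rcases hj : σ.symm j with j' | j' <;>
      simp [Matrix.reindex_apply, hi, hj]
  have hS : IsUnit ((Matrix.fromBlocks K₁⁻¹ 0 0 (c • K₂ - 1)⁻¹).reindex σ σ) := by
    refine ⟨⟨_, (Matrix.fromBlocks K₁ 0 0 (c • K₂ - 1)).reindex σ σ, ?_, ?_⟩, rfl⟩
    · rw [reindex_fromBlocks_mul, Matrix.nonsing_inv_mul _ hK₁d, Matrix.nonsing_inv_mul _ hVd,
        reindex_fromBlocks_one]
    · rw [reindex_fromBlocks_mul, Matrix.mul_nonsing_inv _ hK₁d, Matrix.mul_nonsing_inv _ hVd,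
        reindex_fromBlocks_one]
  exact ⟨{
    n₁ := n₁
    n₂ := n₂
    add_eq := hn
    S := (Matrix.fromBlocks K₁⁻¹ 0 0 (c • K₂ - 1)⁻¹).reindex σ σ * (T⁻¹ * G⁻¹)
    T := T
    J := K₁⁻¹ * (c • K₁ - 1)
    N := (c • K₂ - 1)⁻¹ * K₂
    isUnit_S := hS.mul (((Matrix.isUnit_nonsing_inv_iff).2 hT).mul
      (Matrix.isUnit_nonsing_inv_iff.2 ((Matrix.isUnit_iff_isUnit_det _).2 hGu)))
    isUnit_T := hT
    isNilpotent_N := by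
      -- `N` is a product of commuting factors, one of them nilpotent.
      have h1 : Commute (c • K₂ - 1) K₂ :=
        ((Commute.refl K₂).smul_left c).sub_left (Commute.one_left K₂)
      have h2 : Commute (c • K₂ - 1)⁻¹ K₂ := by
        have h3 := congrArg (fun X => (c • K₂ - 1)⁻¹ * X * (c • K₂ - 1)⁻¹) h1.eq
        simp only [Matrix.mul_assoc, Matrix.mul_nonsing_inv _ hVd, Matrix.mul_one] at h3
        rw [← Matrix.mul_assoc _ (c • K₂ - 1), Matrix.nonsing_inv_mul _ hVd, Matrix.one_mul] at h3
        exact h3.symm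
      exact h2.isNilpotent_mul_left hK₂
    E_eq := by
      have h1 := reindex_fromBlocks_mul σ K₁⁻¹ K₁ (c • K₂ - 1)⁻¹ K₂
      rw [Matrix.nonsing_inv_mul _ hK₁d, ← hE] at h1
      rw [← h1]
      simp only [Matrix.mul_assoc]
    A_eq := by
      have h1 := reindex_fromBlocks_mul σ K₁⁻¹ (c • K₁ - 1) (c • K₂ - 1)⁻¹ (c • K₂ - 1)
      rw [Matrix.nonsing_inv_mul _ hVd, ← hA] at h1
      rw [← h1]
      simp only [Matrix.mul_assoc] }⟩

namespace QuasiWeierstrass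

variable {n l : ℕ} {E A : Matrix (Fin n) (Fin n) ℝ} (Q : QuasiWeierstrass E A)

theorem isUnit_det_T : IsUnit Q.T.det := (Matrix.isUnit_iff_isUnit_det _).1 Q.isUnit_T

theorem conj_mul_conj (X X' : Matrix (Fin Q.n₁) (Fin Q.n₁) ℝ)
    (Y Y' : Matrix (Fin Q.n₂) (Fin Q.n₂) ℝ) :
    Q.conj X Y * Q.conj X' Y' = Q.conj (X * X') (Y * Y') := by
  rw [conj, conj, conj, ← reindex_fromBlocks_mul]
  simp only [Matrix.mul_assoc]
  rw [← Matrix.mul_assoc Q.T⁻¹ Q.T, Matrix.nonsing_inv_mul _ Q.isUnit_det_T, Matrix.one_mul]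

theorem conj_add_conj (X X' : Matrix (Fin Q.n₁) (Fin Q.n₁) ℝ)
    (Y Y' : Matrix (Fin Q.n₂) (Fin Q.n₂) ℝ) :
    Q.conj X Y + Q.conj X' Y' = Q.conj (X + X') (Y + Y') := by
  rw [conj, conj, conj, ← reindex_fromBlocks_add, Matrix.mul_add, Matrix.add_mul]

theorem conj_one : Q.conj 1 1 = 1 := by
  rw [conj, reindex_fromBlocks_one, Matrix.mul_one, Matrix.mul_nonsing_inv _ Q.isUnit_det_T]

theorem conj_zero : Q.conj 0 0 = 0 := by
  rw [conj, Matrix.fromBlocks_zero, Matrix.reindex_apply, Matrix.submatrix_zero]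
  simp

theorem proj_mul_proj : Q.proj * Q.proj = Q.proj := by simp [proj, conj_mul_conj]

theorem proj_mul_Adiff : Q.proj * Q.Adiff = Q.Adiff := by simp [proj, Adiff, conj_mul_conj]

theorem Adiff_mul_proj : Q.Adiff * Q.proj = Q.Adiff := by simp [proj, Adiff, conj_mul_conj]

theorem proj_mul_Eimp : Q.proj * Q.Eimp = 0 := by simp [proj, Eimp, conj_mul_conj, conj_zero]

theorem Eimp_mul_proj : Q.Eimp * Q.proj = 0 := by simp [proj, Eimp, conj_mul_conj, conj_zero]

theorem Eimp_mul_Adiff : Q.Eimp * Q.Adiff = 0 := by simp [Adiff, Eimp, conj_mul_conj, conj_zero]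

theorem Eimp_pow : Q.Eimp ^ n = 0 := by
  refine IsNilpotent.matrix_pow_eq_zero ?_ le_rfl
  obtain ⟨k, hk⟩ := Q.isNilpotent_N
  refine ⟨k + 1, ?_⟩
  -- The shift by one is needed: the zeroth power is the identity, whose first block is not zero.
  have : ∀ j, Q.Eimp ^ (j + 1) = Q.conj 0 (Q.N ^ (j + 1)) := by
    intro j
    induction j with
    | zero => simp [Eimp]
    | succ j ih => rw [pow_succ, ih, Eimp, conj_mul_conj, ← pow_succ, mul_zero]
  rw [this, pow_succ, hk, zero_mul, conj_zero]

/-- Multiplying the DAE by the invertible matrix `T S` splits it into its differential and algebraic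
parts while keeping the original state coordinates. -/
theorem T_mul_S_mul_E : Q.T * Q.S * E = Q.proj + Q.Eimp := by
  have h : Q.T * (Q.S * E * Q.T) * Q.T⁻¹ = Q.conj 1 Q.N := by rw [Q.E_eq, conj]
  rw [← Matrix.mul_assoc, Matrix.mul_nonsing_inv_cancel_right _ _ Q.isUnit_det_T,
    ← Matrix.mul_assoc] at h
  rw [h, proj, Eimp, conj_add_conj, add_zero, zero_add]

theorem T_mul_S_mul_A : Q.T * Q.S * A = Q.Adiff + (1 - Q.proj) := by
  have h : Q.T * (Q.S * A * Q.T) * Q.T⁻¹ = Q.conj Q.J 1 := by rw [Q.A_eq, conj]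
  rw [← Matrix.mul_assoc, Matrix.mul_nonsing_inv_cancel_right _ _ Q.isUnit_det_T,
    ← Matrix.mul_assoc] at h
  have h1 : 1 - Q.proj = Q.conj 0 1 := by
    rw [sub_eq_iff_eq_add, proj, conj_add_conj, zero_add, add_zero, conj_one]
  rw [h, h1, Adiff, conj_add_conj, add_zero, zero_add]

/-- The differential and the algebraic part of the equation `E v = A w`. -/
theorem mulMat_E_eq_iff (v w : EuclideanSpace ℝ (Fin n)) :
    mulMat E v = mulMat A w ↔
      mulMat Q.proj v = mulMat Q.Adiff w ∧ mulMat Q.Eimp v = w - mulMat Q.proj w := by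
  rw [← (mulMat_injective_of_isUnit (Q.isUnit_T.mul Q.isUnit_S)).eq_iff, ← mulMat_mul,
    ← mulMat_mul, T_mul_S_mul_E, T_mul_S_mul_A, mulMat_add, mulMat_add, mulMat_sub, mulMat_one]
  constructor
  · intro h
    -- `Π` fixes the differential terms and annihilates `E^imp` and `1 - Π`, so applying it isolates
    -- the first equation.
    have h1 := congrArg (mulMat Q.proj) h
    simp only [map_add, map_sub, ← mulMat_mul, proj_mul_proj, proj_mul_Eimp, proj_mul_Adiff,
      mulMat_zero, add_zero, sub_self] at h1
    exact ⟨h1, by rwa [h1, add_right_inj] at h⟩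
  · rintro ⟨h1, h2⟩
    rw [h1, h2]

theorem mulMat_Eimp_sub_proj (v : EuclideanSpace ℝ (Fin n)) :
    mulMat Q.Eimp (v - mulMat Q.proj v) = mulMat Q.Eimp v := by
  rw [map_sub, ← mulMat_mul, Eimp_mul_proj, mulMat_zero, sub_zero]

end QuasiWeierstrass

end QuasiWeierstrassForm

/-! ### Local properties of piecewise-smooth distributions -/

namespace PWDist

section Local

variable {V W : Type*} [NormedAddCommGroup V] [NormedSpace ℝ V]
  [NormedAddCommGroup W] [NormedSpace ℝ W]

theorem reg_map (L : V →L[ℝ] W) (D : PWDist V) (s : ℝ) : reg (map L D) s = L (reg D s) := rfl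

theorem imp_map (L : V →L[ℝ] W) (D : PWDist V) (s : ℝ) (j : ℕ) :
    imp (map L D) s j = L (imp D s j) := rfl

theorem reg_restrict_of_mem {a b s : ℝ} (hs : s ∈ Ico a b) (D : PWDist V) :
    reg (restrict a b D) s = reg D s := indicator_of_mem hs _

theorem imp_restrict_of_mem {a b s : ℝ} (hs : s ∈ Ico a b) (D : PWDist V) :
    imp (restrict a b D) s = imp D s := indicator_of_mem hs _

theorem reg_restrict_of_notMem {a b s : ℝ} (hs : s ∉ Ico a b) (D : PWDist V) :
    reg (restrict a b D) s = 0 := indicator_of_notMem hs _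

theorem imp_restrict_of_notMem {a b s : ℝ} (hs : s ∉ Ico a b) (D : PWDist V) :
    imp (restrict a b D) s = 0 := indicator_of_notMem hs _

/-- Turns the distributional equations of a solution into pointwise equations for values and impulse
coefficients. -/
theorem restrict_eq_restrict_iff {a b : ℝ} {D D' : PWDist V} :
    restrict a b D = restrict a b D' ↔
      ∀ s ∈ Ico a b, reg D s = reg D' s ∧ imp D s = imp D' s := by
  constructor
  · intro h s hs
    have h1 := congrFun (congrArg reg h) s
    have h2 := congrFun (congrArg imp h) s
    rw [reg_restrict_of_mem hs, reg_restrict_of_mem hs] at h1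
    rw [imp_restrict_of_mem hs, imp_restrict_of_mem hs] at h2
    exact ⟨h1, h2⟩
  · intro h
    refine PWDist.ext (funext fun s => ?_) (funext fun s => ?_)
    · by_cases hs : s ∈ Ico a b
      · rw [reg_restrict_of_mem hs, reg_restrict_of_mem hs, (h s hs).1]
      · rw [reg_restrict_of_notMem hs, reg_restrict_of_notMem hs]
    · by_cases hs : s ∈ Ico a b
      · rw [imp_restrict_of_mem hs, imp_restrict_of_mem hs, (h s hs).2]
      · rw [imp_restrict_of_notMem hs, imp_restrict_of_notMem hs]

theorem hasDerivWithinAt_reg (D : PWDist V) (s : ℝ) :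
    HasDerivWithinAt (reg D) (reg (deriv D) s) (Ici s) s := D.isPWSmooth.hasDerivWithinAt s

theorem reg_deriv_eq {D : PWDist V} {s : ℝ} {v : V} (h : HasDerivWithinAt (reg D) v (Ici s) s) :
    reg (deriv D) s = v := h.derivWithin (uniqueDiffWithinAt_Ici s)

theorem imp_deriv_zero (D : PWDist V) (s : ℝ) :
    imp (deriv D) s 0 = reg D s - leftVal s D := by
  change (Finsupp.single 0 (rightVal s D - leftVal s D) +
    (imp D s).mapDomain Nat.succ : ℕ →₀ V) 0 = _
  rw [Finsupp.add_apply, Finsupp.single_eq_same, Finsupp.mapDomain_of_notMem_range, add_zero]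
  · rfl
  · simp

theorem imp_deriv_succ (D : PWDist V) (s : ℝ) (j : ℕ) :
    imp (deriv D) s (j + 1) = imp D s j := by
  change (Finsupp.single 0 (rightVal s D - leftVal s D) +
    (imp D s).mapDomain Nat.succ : ℕ →₀ V) (j + 1) = _
  rw [Finsupp.add_apply, Finsupp.single_eq_of_ne (by simp), zero_add]
  exact Finsupp.mapDomain_apply Nat.succ_injective _ _

theorem reg_deriv_congr {D D' : PWDist V} {s : ℝ} (h : reg D =ᶠ[𝓝[≥] s] reg D') :
    reg (deriv D) s = reg (deriv D') s :=
  reg_deriv_eq ((hasDerivWithinAt_reg D' s).congr_of_eventuallyEq h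
    (h.self_of_nhdsWithin (mem_Ici.2 le_rfl)))

/-- The regular part of the derivative is a right derivative, so agreement on a half-open interval
suffices even at its left end. -/
theorem reg_deriv_congr_Ico {a b : ℝ} {D D' : PWDist V} (h : EqOn (reg D) (reg D') (Ico a b))
    {s : ℝ} (hs : s ∈ Ico a b) : reg (deriv D) s = reg (deriv D') s := by
  apply reg_deriv_congr
  filter_upwards [Ico_mem_nhdsGE hs.2] with r hr
  exact h ⟨hs.1.trans hr.1, hr.2⟩

theorem reg_deriv_map (L : V →L[ℝ] W) (D : PWDist V) (s : ℝ) :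
    reg (deriv (map L D)) s = L (reg (deriv D) s) :=
  reg_deriv_eq (L.hasFDerivAt.comp_hasDerivWithinAt s (hasDerivWithinAt_reg D s))

theorem leftVal_eq_of_tendsto {D : PWDist V} {s : ℝ} {v : V}
    (h : Tendsto (reg D) (𝓝[<] s) (𝓝 v)) : leftVal s D = v :=
  tendsto_nhds_unique (tendsto_leftVal D s) h

theorem leftVal_congr {D D' : PWDist V} {s : ℝ} (h : reg D =ᶠ[𝓝[<] s] reg D') :
    leftVal s D = leftVal s D' :=
  leftVal_eq_of_tendsto ((tendsto_leftVal D' s).congr' h.symm)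

theorem imp_deriv_congr {D D' : PWDist V} {s : ℝ} (h1 : reg D s = reg D' s)
    (h2 : leftVal s D = leftVal s D') (h3 : imp D s = imp D' s) (j : ℕ) :
    imp (deriv D) s j = imp (deriv D') s j := by
  cases j with
  | zero => rw [imp_deriv_zero, imp_deriv_zero, h1, h2]
  | succ j => rw [imp_deriv_succ, imp_deriv_succ, h3]

end Local

end PWDist

/-! ### Solutions of one mode -/

section Mode

open PWDist

variable {n : ℕ} {E A : Matrix (Fin n) (Fin n) ℝ} {a b : ℝ}
  {x : PWDist (EuclideanSpace ℝ (Fin n))}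

/-- `x` solves `E x' = A x` on `[a, b)`. -/
def IsModeSolution (E A : Matrix (Fin n) (Fin n) ℝ) (a b : ℝ)
    (x : PWDist (EuclideanSpace ℝ (Fin n))) : Prop :=
  ∀ s ∈ Ico a b, mulMat E (reg (deriv x) s) = mulMat A (reg x s) ∧
    ∀ j, mulMat E (imp (deriv x) s j) = mulMat A (imp x s j)

/-- The equations on `[a, b)` see the past only through the jump at `a`, that is, through the left
limit there. -/
theorem IsModeSolution.congr {y : PWDist (EuclideanSpace ℝ (Fin n))} (hx : IsModeSolution E A a b x)
    (h1 : EqOn (reg y) (reg x) (Ico a b)) (h2 : EqOn (imp y) (imp x) (Ico a b))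
    (h3 : leftVal a y = leftVal a x) : IsModeSolution E A a b y := by
  intro s hs
  have hl : leftVal s y = leftVal s x := by
    rcases hs.1.eq_or_lt with rfl | h
    · exact h3
    · apply leftVal_congr
      filter_upwards [Ioo_mem_nhdsLT h] with r hr
      exact h1 ⟨hr.1.le, hr.2.trans hs.2⟩
  refine ⟨?_, fun j => ?_⟩
  · rw [reg_deriv_congr_Ico h1 hs, h1 hs, (hx s hs).1]
  · rw [imp_deriv_congr (h1 hs) hl (h2 hs), h2 hs, (hx s hs).2]

namespace IsModeSolution

/-- Comparing coefficients of `δ^{(j+1)}` in the differential part gives `Π x_j = A^diff Π x_{j+1}`.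
An impulse has finite order, so vanishing propagates down from the top coefficient. -/
theorem proj_imp (hx : IsModeSolution E A a b x) (Q : QuasiWeierstrass E A)
    {s : ℝ} (hs : s ∈ Ico a b) (j : ℕ) : mulMat Q.proj (imp x s j) = 0 := by
  obtain ⟨N, hN⟩ : ∃ N, ∀ j, N ≤ j → imp x s j = 0 := by
    refine ⟨(imp x s).support.sup id + 1, fun j hj => ?_⟩
    by_contra h
    have := Finset.le_sup (f := id) (Finsupp.mem_support_iff.2 h)
    simp only [id] at this
    omega
  have key : ∀ i j, N ≤ j + i → mulMat Q.proj (imp x s j) = 0 := by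
    intro i
    induction i with
    | zero => intro j hj; rw [hN j hj, map_zero]
    | succ i ih =>
      intro j hj
      have h := ((Q.mulMat_E_eq_iff _ _).1 ((hx s hs).2 (j + 1))).1
      rw [imp_deriv_succ, ← Q.Adiff_mul_proj, mulMat_mul, ih (j + 1) (by omega), map_zero] at h
      exact h
  exact key N j (by omega)

/-- The coefficient of `δ` in the differential part equates `Π` of the jump with `A^diff Π x_0`,
which is zero. -/
theorem proj_jump (hx : IsModeSolution E A a b x) (Q : QuasiWeierstrass E A)
    {s : ℝ} (hs : s ∈ Ico a b) :
    mulMat Q.proj (reg x s) = mulMat Q.proj (leftVal s x) := by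
  have h := ((Q.mulMat_E_eq_iff _ _).1 ((hx s hs).2 0)).1
  rw [imp_deriv_zero, ← Q.Adiff_mul_proj, mulMat_mul, hx.proj_imp Q hs, map_zero, map_sub] at h
  exact sub_eq_zero.1 h

/-- The algebraic part reads `(1 - Π) x = E^imp x'`, and `E^imp` sees only `(1 - Π) x`. Substituting
the equation into itself gives `(1 - Π) x = (E^imp)^i x^{(i)}` for all `i ≥ 1`, and nilpotency makes
this zero. -/
theorem proj_reg (hx : IsModeSolution E A a b x) (Q : QuasiWeierstrass E A)
    {s : ℝ} (hs : s ∈ Ico a b) : mulMat Q.proj (reg x s) = reg x s := by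
  have key : ∀ i : ℕ, ∀ s ∈ Ico a b, reg (x - map (mulMat Q.proj) x) s =
      reg (map (mulMat (Q.Eimp ^ (i + 1))) (PWDist.deriv^[i + 1] x)) s := by
    intro i
    induction i with
    | zero =>
      intro s hs
      have h := ((Q.mulMat_E_eq_iff _ _).1 (hx s hs).1).2
      rw [map_sub, Pi.sub_apply, reg_map, reg_map, zero_add, pow_one]
      exact h.symm
    | succ i ih =>
      intro s hs
      have h := ((Q.mulMat_E_eq_iff _ _).1 (hx s hs).1).2
      have h2 := reg_deriv_congr_Ico ih hs
      rw [map_sub, map_sub, Pi.sub_apply, reg_deriv_map, reg_deriv_map] at h2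
      rw [map_sub, Pi.sub_apply, reg_map, reg_map, ← h, ← Q.mulMat_Eimp_sub_proj, h2,
        ← mulMat_mul, ← pow_succ', Function.iterate_succ_apply' _ (i + 1)]
  have h := key n s hs
  rw [reg_map, pow_succ, Q.Eimp_pow, zero_mul, mulMat_zero, map_sub, Pi.sub_apply, reg_map] at h
  exact (sub_eq_zero.1 h).symm

/-- As `Π` kills the impulses, the algebraic part becomes the recursion `x_{j+1} = E^imp x_j`. It
starts from `x_0 = E^imp (x(s⁺) - x(s⁻)) = -E^imp x(s⁻)`, because `x(s⁺)` lies in the image of `Π`.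
-/
theorem imp_eq (hx : IsModeSolution E A a b x) (Q : QuasiWeierstrass E A)
    {s : ℝ} (hs : s ∈ Ico a b) (j : ℕ) :
    imp x s j = -mulMat (Q.Eimp ^ (j + 1)) (leftVal s x) := by
  have h := fun j => ((Q.mulMat_E_eq_iff _ _).1 ((hx s hs).2 j)).2
  simp only [hx.proj_imp Q hs, sub_zero] at h
  induction j with
  | zero =>
    rw [← h, imp_deriv_zero, map_sub, ← hx.proj_reg Q hs, ← mulMat_mul, Q.Eimp_mul_proj,
      mulMat_zero, zero_sub, zero_add, pow_one]
  | succ j ih =>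
    rw [← h, imp_deriv_succ, ih, map_neg, ← mulMat_mul, ← pow_succ']

theorem proj_leftVal (hx : IsModeSolution E A a b x) (Q : QuasiWeierstrass E A)
    {s : ℝ} (hs : s ∈ Ioc a b) :
    mulMat Q.proj (leftVal s x) = leftVal s x := by
  have h1 := (mulMat Q.proj).continuous.continuousAt.tendsto.comp (tendsto_leftVal x s)
  refine tendsto_nhds_unique h1 ((tendsto_leftVal x s).congr' ?_)
  filter_upwards [Ioo_mem_nhdsLT hs.1] with r hr
  exact (hx.proj_reg Q ⟨hr.1.le, hr.2.trans_le hs.2⟩).symm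

/-- There are no jumps inside a mode interval: both one-sided values lie in the image of `Π`, and `Π
x` does not jump. -/
theorem leftVal_eq_reg (hx : IsModeSolution E A a b x) (Q : QuasiWeierstrass E A)
    {s : ℝ} (hs : s ∈ Ioo a b) : leftVal s x = reg x s := by
  rw [← hx.proj_leftVal Q (Ioo_subset_Ioc_self hs), ← hx.proj_jump Q (Ioo_subset_Ico_self hs),
    hx.proj_reg Q (Ioo_subset_Ico_self hs)]

/-- The regular part solves `x' = A^diff x` in the sense of right derivatives and is continuous up
to the left end, where its value is `Π x(a⁻)`. Uniqueness for Lipschitz ODEs identifies it with the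
exponential. -/
theorem reg_eq (hx : IsModeSolution E A a b x) (Q : QuasiWeierstrass E A)
    {s : ℝ} (hs : s ∈ Ico a b) :
    reg x s = mulMat (NormedSpace.exp ((s - a) • Q.Adiff)) (mulMat Q.proj (leftVal a x)) := by
  have ha : a ∈ Ico a b := ⟨le_rfl, hs.1.trans_lt hs.2⟩
  refine ODE_solution_unique (a := a) (b := s) (v := fun _ => mulMat Q.Adiff)
    (fun _ => (mulMat Q.Adiff).lipschitz) ?_ ?_
    (fun r _ => (hasDerivAt_mulMat_exp Q.Adiff _ a r).continuousAt.continuousWithinAt)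
    (fun r _ => (hasDerivAt_mulMat_exp Q.Adiff _ a r).hasDerivWithinAt) ?_
    (right_mem_Icc.2 hs.1)
  · intro r hr
    have hr' : r ∈ Ico a b := ⟨hr.1, hr.2.trans_lt hs.2⟩
    have h1 : ContinuousWithinAt (reg x) (Ici r) r := (hasDerivWithinAt_reg x r).continuousWithinAt
    rcases hr.1.eq_or_lt with rfl | h
    · exact h1.mono Icc_subset_Ici_self
    · have h2 : ContinuousWithinAt (reg x) (Iio r) r := by
        have := tendsto_leftVal x r
        rwa [hx.leftVal_eq_reg Q ⟨h, hr'.2⟩] at this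
      have h3 := h2.union h1
      rw [Iio_union_Ici] at h3
      exact h3.mono (subset_univ _)
  · intro r hr
    have hr' : r ∈ Ico a b := ⟨hr.1, hr.2.trans hs.2⟩
    have h1 : ∀ r ∈ Ico a b, reg x r = reg (map (mulMat Q.proj) x) r :=
      fun r hr => (hx.proj_reg Q hr).symm
    have h2 := reg_deriv_congr_Ico h1 hr'
    rw [reg_deriv_map, ((Q.mulMat_E_eq_iff _ _).1 (hx r hr').1).1] at h2
    rw [← h2]
    exact hasDerivWithinAt_reg x r
  · rw [sub_self, exp_zero_smul_matrix, mulMat_one, ← hx.proj_jump Q ha, hx.proj_reg Q ha]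

theorem leftVal_eq (hx : IsModeSolution E A a b x) (Q : QuasiWeierstrass E A)
    (hab : a < b) :
    leftVal b x = mulMat (NormedSpace.exp ((b - a) • Q.Adiff)) (mulMat Q.proj (leftVal a x)) := by
  apply leftVal_eq_of_tendsto
  refine Tendsto.congr' (f₁ := fun s => mulMat (NormedSpace.exp ((s - a) • Q.Adiff))
    (mulMat Q.proj (leftVal a x))) ?_
    ((hasDerivAt_mulMat_exp Q.Adiff _ a b).continuousAt.tendsto.mono_left nhdsWithin_le_nhds)
  filter_upwards [Ioo_mem_nhdsLT hab] with r hr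
  exact (hx.reg_eq Q (Ioo_subset_Ico_self hr)).symm

end IsModeSolution

/-! ### Explicit solutions of one mode with an arbitrary past -/

namespace QuasiWeierstrass

variable (Q : QuasiWeierstrass E A)

theorem isPWSmooth_ite {V : Type*} [NormedAddCommGroup V] [NormedSpace ℝ V] {f g : ℝ → V}
    (hf : ContDiff ℝ ∞ f) (hg : ContDiff ℝ ∞ g) (a : ℝ) :
    IsPWSmooth fun s => if s < a then f s else g s := by
  intro t
  constructor
  · rcases le_or_gt t a with h | h
    · refine ⟨f, hf, ?_⟩
      filter_upwards [self_mem_nhdsWithin] with s hs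
      exact if_pos (lt_of_lt_of_le hs h)
    · refine ⟨g, hg, ?_⟩
      filter_upwards [Ioo_mem_nhdsLT h] with s hs
      exact if_neg hs.1.not_gt
  · rcases lt_or_ge t a with h | h
    · refine ⟨f, hf, ?_⟩
      filter_upwards [Ico_mem_nhdsGE h] with s hs
      exact if_pos hs.2
    · refine ⟨g, hg, ?_⟩
      filter_upwards [self_mem_nhdsWithin] with s hs
      exact if_neg (h.trans hs).not_gt

/-- The solution of `E x' = A x` on `[a, ∞)` with the past `x = v` on `(-∞, a)`. -/
noncomputable def solution (a : ℝ) (v : EuclideanSpace ℝ (Fin n)) :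
    PWDist (EuclideanSpace ℝ (Fin n)) :=
  ⟨(fun s => if s < a then v else
      mulMat (NormedSpace.exp ((s - a) • Q.Adiff)) (mulMat Q.proj v),
    fun s => if s = a then ∑ j ∈ Finset.range n, Finsupp.single j (-mulMat (Q.Eimp ^ (j + 1)) v)
      else 0),
    isPWSmooth_ite contDiff_const (contDiff_mulMat_exp _ _ _) a, fun t => by
      rcases eq_or_ne t a with rfl | h
      · filter_upwards [self_mem_nhdsWithin] with s hs
        exact if_neg hs
      · filter_upwards [mem_nhdsWithin_of_mem_nhds (isOpen_ne.mem_nhds h)] with s hs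
        exact if_neg hs⟩

variable {Q}

theorem reg_solution_of_lt {v : EuclideanSpace ℝ (Fin n)} {s : ℝ} (hs : s < a) :
    reg (Q.solution a v) s = v := if_pos hs

theorem reg_solution_of_le {v : EuclideanSpace ℝ (Fin n)} {s : ℝ} (hs : a ≤ s) :
    reg (Q.solution a v) s =
      mulMat (NormedSpace.exp ((s - a) • Q.Adiff)) (mulMat Q.proj v) := if_neg hs.not_gt

theorem imp_solution_of_ne {v : EuclideanSpace ℝ (Fin n)} {s : ℝ} (hs : s ≠ a) :
    imp (Q.solution a v) s = 0 := if_neg hs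

/-- Truncating the impulse at order `n` loses nothing, since `(E^imp)^(j+1) = 0` for `j ≥ n`. -/
theorem imp_solution {v : EuclideanSpace ℝ (Fin n)} (j : ℕ) :
    imp (Q.solution a v) a j = -mulMat (Q.Eimp ^ (j + 1)) v := by
  have : imp (Q.solution a v) a =
      ∑ j ∈ Finset.range n, Finsupp.single j (-mulMat (Q.Eimp ^ (j + 1)) v) := if_pos rfl
  rw [this, Finsupp.finsetSum_apply]
  rcases lt_or_ge j n with h | h
  · rw [Finset.sum_eq_single j, Finsupp.single_eq_same]
    · intro i _ hij
      exact Finsupp.single_eq_of_ne hij.symm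
    · intro hj
      exact absurd (Finset.mem_range.2 h) hj
  · rw [pow_eq_zero_of_le (h.trans (Nat.le_succ j)) Q.Eimp_pow, mulMat_zero, neg_zero]
    refine Finset.sum_eq_zero fun i hi => Finsupp.single_eq_of_ne ?_
    have := Finset.mem_range.1 hi
    omega

theorem leftVal_solution {v : EuclideanSpace ℝ (Fin n)} : leftVal a (Q.solution a v) = v := by
  apply leftVal_eq_of_tendsto
  refine tendsto_const_nhds.congr' ?_
  filter_upwards [self_mem_nhdsWithin] with s hs
  exact (reg_solution_of_lt hs).symm

/-- Every past value `v` is admissible: the jump and the impulses at `a` absorb its inconsistent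
part `(1 - Π) v`. -/
theorem isModeSolution_solution (v : EuclideanSpace ℝ (Fin n)) :
    IsModeSolution E A a b (Q.solution a v) := by
  intro s hs
  have hproj : ∀ r, mulMat Q.proj (mulMat (NormedSpace.exp ((r - a) • Q.Adiff)) (mulMat Q.proj v)) =
      mulMat (NormedSpace.exp ((r - a) • Q.Adiff)) (mulMat Q.proj v) := by
    intro r
    have hc : Commute Q.proj Q.Adiff := Q.proj_mul_Adiff.trans Q.Adiff_mul_proj.symm
    rw [← mulMat_mul, (commute_exp_smul hc _).eq, mulMat_mul, ← mulMat_mul Q.proj Q.proj,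
      Q.proj_mul_proj]
  constructor
  · have h : reg (deriv (Q.solution a v)) s = mulMat Q.Adiff (reg (Q.solution a v) s) := by
      apply reg_deriv_eq
      rw [reg_solution_of_le hs.1]
      refine (hasDerivAt_mulMat_exp Q.Adiff _ a s).hasDerivWithinAt.congr_of_mem
        (fun r hr => reg_solution_of_le (hs.1.trans hr)) (mem_Ici.2 le_rfl)
    rw [Q.mulMat_E_eq_iff, h, ← mulMat_mul, ← mulMat_mul, Q.proj_mul_Adiff, Q.Eimp_mul_Adiff,
      reg_solution_of_le hs.1, hproj, mulMat_zero, sub_self]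
    exact ⟨rfl, rfl⟩
  · intro j
    rw [Q.mulMat_E_eq_iff]
    rcases hs.1.eq_or_lt with rfl | h
    · have h1 : ∀ j, mulMat Q.proj (imp (Q.solution a v) a j) = 0 := fun j => by
        rw [imp_solution, map_neg, ← mulMat_mul, pow_succ', ← Matrix.mul_assoc, Q.proj_mul_Eimp,
          Matrix.zero_mul, mulMat_zero, neg_zero]
      have h2 : ∀ j, mulMat Q.Adiff (imp (Q.solution a v) a j) = 0 := fun j => by
        rw [← Q.Adiff_mul_proj, mulMat_mul, h1, map_zero]
      rw [h1, h2, sub_zero]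
      cases j with
      | zero =>
        rw [imp_deriv_zero, leftVal_solution, reg_solution_of_le le_rfl, imp_solution, sub_self,
          exp_zero_smul_matrix, mulMat_one, map_sub, map_sub, ← mulMat_mul, ← mulMat_mul,
          Q.proj_mul_proj, Q.Eimp_mul_proj, mulMat_zero, sub_self, zero_sub, zero_add, pow_one]
        exact ⟨rfl, rfl⟩
      | succ j =>
        rw [imp_deriv_succ, h1, imp_solution, imp_solution, map_neg, ← mulMat_mul, ← pow_succ']
        exact ⟨rfl, rfl⟩
    -- After `a` the regular part is continuous and there are no impulses, so the derivative has
    -- none either.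
    · have h1 : imp (deriv (Q.solution a v)) s j = 0 := by
        cases j with
        | zero =>
          rw [imp_deriv_zero, sub_eq_zero]
          symm
          apply leftVal_eq_of_tendsto
          rw [reg_solution_of_le hs.1]
          refine Tendsto.congr' ?_ ((hasDerivAt_mulMat_exp Q.Adiff (mulMat Q.proj v) a
            s).continuousAt.tendsto.mono_left nhdsWithin_le_nhds)
          filter_upwards [Ioo_mem_nhdsLT h] with r hr
          exact (reg_solution_of_le hr.1.le).symm
        | succ j => rw [imp_deriv_succ, imp_solution_of_ne h.ne']; rfl
      rw [h1, imp_solution_of_ne h.ne']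
      simp

end QuasiWeierstrass

end Mode

/-! ### Unobservable spaces and existence of a design -/

section Design

/-- Apply the continuous linear map `X ↦ C X v` to the exponential series; every term vanishes. -/
theorem mulMat_mul_exp_eq_zero {a b : ℕ} {C : Matrix (Fin b) (Fin a) ℝ}
    {M : Matrix (Fin a) (Fin a) ℝ} {v : EuclideanSpace ℝ (Fin a)}
    (h : ∀ i, mulMat (C * M ^ i) v = 0) (s : ℝ) :
    mulMat C (mulMat (NormedSpace.exp (s • M)) v) = 0 := by
  let _ : NormedRing (Matrix (Fin a) (Fin a) ℝ) := Matrix.linftyOpNormedRing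
  let _ : NormedAlgebra ℝ (Matrix (Fin a) (Fin a) ℝ) := Matrix.linftyOpNormedAlgebra
  let L : Matrix (Fin a) (Fin a) ℝ →ₗ[ℝ] EuclideanSpace ℝ (Fin b) :=
    { toFun := fun X => mulMat C (mulMat X v)
      map_add' := fun X Y => by rw [mulMat_add, map_add]
      map_smul' := fun r X => by
        rw [RingHom.id_apply, ← map_smul]
        congr 1
        apply WithLp.ofLp_injective
        simp [ofLp_mulMat, Matrix.smul_mulVec] }
  have h1 := (LinearMap.toContinuousLinearMap L).hasSum
    (NormedSpace.exp_series_hasSum_exp' (𝕂 := ℝ) (s • M))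
  have h2 : ∀ i : ℕ, L ((i.factorial : ℝ)⁻¹ • (s • M) ^ i) = 0 := by
    intro i
    rw [smul_pow, map_smul, map_smul]
    have : L (M ^ i) = 0 := by
      rw [← h i, mulMat_mul]
      rfl
    rw [this, smul_zero, smul_zero]
  refine h1.unique ?_
  convert! hasSum_zero using 1
  exact funext h2

namespace QuasiWeierstrass

variable {n l : ℕ} {E A : Matrix (Fin n) (Fin n) ℝ} {Q : QuasiWeierstrass E A}
  {C : Matrix (Fin l) (Fin n) ℝ}

theorem Odiff_mulVec_eq_zero_iff {v : EuclideanSpace ℝ (Fin n)} :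
    (Q.Odiff C).mulVec v.ofLp = 0 ↔ ∀ i, mulMat (Q.Cdiff C * Q.Adiff ^ i) v = 0 := by
  constructor
  · intro h
    apply mulMat_mul_pow_eq_zero
    intro i hi
    apply WithLp.ofLp_injective
    funext r
    exact congrFun h (⟨i, hi⟩, r)
  · intro h
    funext ⟨i, r⟩
    exact congrFun (congrArg WithLp.ofLp (h i)) r

/-- The rows may stop at the power `n - 1` because `(E^imp)^n = 0`. -/
theorem Oimp_mulVec_eq_zero_iff {v : EuclideanSpace ℝ (Fin n)} :
    (Q.Oimp C).mulVec v.ofLp = 0 ↔ ∀ i, mulMat (C * Q.Eimp ^ (i + 1)) v = 0 := by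
  constructor
  · intro h i
    rcases lt_or_ge i (n - 1) with hi | hi
    · apply WithLp.ofLp_injective
      funext r
      exact congrFun h (⟨i, hi⟩, r)
    · rw [pow_eq_zero_of_le (by omega) Q.Eimp_pow, Matrix.mul_zero, mulMat_zero]
  · intro h
    funext ⟨i, r⟩
    exact congrFun (congrArg WithLp.ofLp (h i)) r

theorem mulMat_Cdiff_mul_pow_proj (i : ℕ) (v : EuclideanSpace ℝ (Fin n)) :
    mulMat (C * Q.Adiff ^ i) (mulMat Q.proj v) = mulMat (Q.Cdiff C * Q.Adiff ^ i)
      (mulMat Q.proj v) := by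
  have h : Commute Q.proj Q.Adiff := Q.proj_mul_Adiff.trans Q.Adiff_mul_proj.symm
  rw [Cdiff, Matrix.mul_assoc, (h.pow_right i).eq, ← Matrix.mul_assoc,
    mulMat_mul (C * Q.Adiff ^ i) Q.proj, ← mulMat_mul Q.proj Q.proj, Q.proj_mul_proj]

end QuasiWeierstrass

/-! ### Zero-output solutions of the switched system -/

namespace SwitchedDAE

open PWDist

variable {n m l : ℕ} {S : SwitchedDAE n m l} {p q k : ℕ}
  {x x' : PWDist (EuclideanSpace ℝ (Fin n))} {u : PWDist (EuclideanSpace ℝ (Fin m))}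
  {y y' : PWDist (EuclideanSpace ℝ (Fin l))}

theorem isSolution_zero_iff : S.IsSolution p q x 0 y ↔ ∀ k, p ≤ k → k < q →
    IsModeSolution (S.E k) (S.A k) (S.t k) (S.t (k + 1)) x ∧
      ∀ s ∈ Ico (S.t k) (S.t (k + 1)), reg y s = mulMat (S.C k) (reg x s) ∧
        ∀ j, imp y s j = mulMat (S.C k) (imp x s j) := by
  simp only [IsSolution, map_zero, add_zero, PWDist.restrict_eq_restrict_iff, Finsupp.ext_iff,
    reg_map, imp_map, IsModeSolution]

theorem IsSolution.sub (h : S.IsSolution p q x u y) (h' : S.IsSolution p q x' u y') :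
    S.IsSolution p q (x' - x) 0 (y' - y) := by
  intro k hk hk'
  have h1 := h k hk hk'
  have h2 := h' k hk hk'
  constructor
  · rw [map_sub, map_sub, map_sub, h2.1, h1.1, ← map_sub, add_sub_add_right_eq_sub, map_zero,
      add_zero, map_sub (PWDist.map (mulMat (S.A k)))]
  · rw [map_sub, h2.2, h1.2, ← map_sub, add_sub_add_right_eq_sub, map_zero,
      add_zero, map_sub (PWDist.map (mulMat (S.C k)))]

/-- The explicit solution with past `v` has output `C exp((t - t_k) A^diff) Π v` and output impulse
coefficients `-C (E^imp)^(j+1) v`; the two hypotheses make both vanish. -/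
theorem mem_localUnobs (Q : QuasiWeierstrass (S.E k) (S.A k)) {v : EuclideanSpace ℝ (Fin n)}
    (h1 : (Q.Odiff (S.C k)).mulVec (mulMat Q.proj v).ofLp = 0)
    (h2 : (Q.Oimp (S.C k)).mulVec v.ofLp = 0) : v ∈ S.localUnobs k := by
  rw [QuasiWeierstrass.Odiff_mulVec_eq_zero_iff] at h1
  rw [QuasiWeierstrass.Oimp_mulVec_eq_zero_iff] at h2
  refine ⟨Q.solution (S.t k) v, isSolution_zero_iff.2 fun j hj hj' => ?_,
    QuasiWeierstrass.leftVal_solution⟩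
  obtain rfl : j = k := by omega
  refine ⟨QuasiWeierstrass.isModeSolution_solution v, fun s hs => ⟨?_, fun i => ?_⟩⟩
  · rw [QuasiWeierstrass.reg_solution_of_le hs.1, map_zero, mulMat_mul_exp_eq_zero]
    · rfl
    · intro i
      rw [Q.mulMat_Cdiff_mul_pow_proj, h1]
  · rcases eq_or_ne s (S.t j) with rfl | hne
    · rw [QuasiWeierstrass.imp_solution, map_neg, ← mulMat_mul, h2, neg_zero, map_zero]
      rfl
    · rw [QuasiWeierstrass.imp_solution_of_ne hne, map_zero, Finsupp.zero_apply, map_zero]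
      rfl

/-- Solutions with zero output on `[t_k, t_{k+1})` and on `[t_{k+1}, t_q)` can be concatenated. -/
theorem mem_unobs (Q : QuasiWeierstrass (S.E k) (S.A k))
    {v : EuclideanSpace ℝ (Fin n)} (h1 : v ∈ S.localUnobs k)
    (h2 : mulMat (NormedSpace.exp (S.τ k • Q.Adiff)) (mulMat Q.proj v) ∈ S.unobs (k + 1) q) :
    v ∈ S.unobs k q := by
  obtain ⟨e₁, he₁, rfl⟩ := h1
  obtain ⟨e₂, he₂, h⟩ := h2
  have hlt : S.t k < S.t (k + 1) := S.t_strictMono (Nat.lt_succ_self k)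
  rw [isSolution_zero_iff] at he₁ he₂
  have hm := (he₁ k le_rfl (Nat.lt_succ_self k)).1
  rw [τ, ← hm.leftVal_eq Q hlt] at h
  -- The glued trajectory is `e₁` before `t_{k+1}` and `e₂` on `[t_{k+1}, t_q)`.
  set e := e₁ + restrict (S.t (k + 1)) (S.t q) (e₂ - e₁) with he
  have hreg : ∀ s, s < S.t (k + 1) → reg e s = reg e₁ s := by
    intro s hs
    rw [he, map_add, Pi.add_apply, reg_restrict_of_notMem (fun h => h.1.not_gt hs), add_zero]
  have himp : ∀ s, s < S.t (k + 1) → imp e s = imp e₁ s := by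
    intro s hs
    rw [he, map_add, Pi.add_apply, imp_restrict_of_notMem (fun h => h.1.not_gt hs), add_zero]
  have hreg' : ∀ s ∈ Ico (S.t (k + 1)) (S.t q), reg e s = reg e₂ s := by
    intro s hs
    rw [he, map_add, Pi.add_apply, reg_restrict_of_mem hs, map_sub, Pi.sub_apply, add_sub_cancel]
  have himp' : ∀ s ∈ Ico (S.t (k + 1)) (S.t q), imp e s = imp e₂ s := by
    intro s hs
    rw [he, map_add, Pi.add_apply, imp_restrict_of_mem hs, map_sub, Pi.sub_apply, add_sub_cancel]
  have hleft : ∀ s, s ≤ S.t (k + 1) → leftVal s e = leftVal s e₁ := by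
    intro s hs
    apply leftVal_congr
    filter_upwards [self_mem_nhdsWithin] with r hr
    exact hreg r (lt_of_lt_of_le hr hs)
  have hleft' : ∀ s ∈ Ico (S.t (k + 1)) (S.t q), leftVal s e = leftVal s e₂ := by
    intro s hs
    rcases hs.1.eq_or_lt with rfl | h'
    -- At the gluing point the past comes from `e₁`; by `h` its left limit is the one with which
    -- `e₂` enters the next mode, so no equation changes there.
    · rw [hleft _ le_rfl, h]
    · apply leftVal_congr
      filter_upwards [Ioo_mem_nhdsLT h'] with r hr
      exact hreg' r ⟨hr.1.le, hr.2.trans hs.2⟩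
  refine ⟨e, isSolution_zero_iff.2 fun j hj hj' => ?_, hleft _ hlt.le⟩
  rcases hj.eq_or_lt with rfl | hkj
  · refine ⟨hm.congr (fun s hs => hreg s hs.2) (fun s hs => himp s hs.2) (hleft _ hlt.le),
      fun s hs => ?_⟩
    rw [hreg s hs.2, himp s hs.2]
    exact (he₁ k le_rfl (Nat.lt_succ_self k)).2 s hs
  · have hj1 := S.t_strictMono.monotone hkj
    have hj2 := S.t_strictMono.monotone hj'
    have hsub : ∀ s ∈ Ico (S.t j) (S.t (j + 1)), s ∈ Ico (S.t (k + 1)) (S.t q) := fun s hs =>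
      ⟨hj1.trans hs.1, hs.2.trans_le hj2⟩
    refine ⟨(he₂ j hkj hj').1.congr (fun s hs => hreg' s (hsub s hs))
      (fun s hs => himp' s (hsub s hs))
      (hleft' _ (hsub _ ⟨le_rfl, S.t_strictMono (Nat.lt_succ_self j)⟩)), fun s hs => ?_⟩
    rw [hreg' s (hsub s hs), himp' s (hsub s hs)]
    exact (he₂ j hkj hj').2 s hs

/-- A matrix with orthonormal columns which span a given subspace. -/
noncomputable def orthonormalMatrix {n : ℕ} (W : Submodule ℝ (EuclideanSpace ℝ (Fin n))) :
    Matrix (Fin n) (Fin (Module.finrank ℝ W)) ℝ := (exists_orthonormal_colSpace_eq W).choose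

theorem orthonormalMatrix_transpose_mul (W : Submodule ℝ (EuclideanSpace ℝ (Fin n))) :
    (orthonormalMatrix W).transpose * orthonormalMatrix W = 1 :=
  (exists_orthonormal_colSpace_eq W).choose_spec.1

theorem colSpace_orthonormalMatrix (W : Submodule ℝ (EuclideanSpace ℝ (Fin n))) :
    colSpace (orthonormalMatrix W) = W := (exists_orthonormal_colSpace_eq W).choose_spec.2

/-- Bases come from orthonormal bases of the prescribed subspaces; the matrices `U` come from column
space inclusions checked on orthogonal complements. For `U^obs`, a vector orthogonal to all columns
lies in `𝒲_k` by `mem_localUnobs`. For `U_k^q`, it lies in `𝒲_k` and `Π v ∈ exp(-A^diff τ_k)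
𝒩_{k+1}^q`, hence it lies in `𝒩_k^q` by `mem_unobs`. -/
theorem nonempty_observerDesign (S : SwitchedDAE n m l)
    (hreg : ∀ k, IsRegularPair (S.E k) (S.A k)) (p q : ℕ) : Nonempty (S.ObserverDesign p q) := by
  have Q : ∀ k, QuasiWeierstrass (S.E k) (S.A k) := fun k =>
    (hreg k).nonempty_quasiWeierstrass.some
  let Zd := fun k => orthonormalMatrix (colSpace ((Q k).Odiff (S.C k)).transpose)
  let Zi := fun k => orthonormalMatrix (colSpace ((Q k).Oimp (S.C k)).transpose)
  let Z := fun k => orthonormalMatrix (S.localUnobs k)ᗮ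
  let M := fun k => orthonormalMatrix (S.unobs k q)ᗮ
  let Θ := fun k => orthonormalMatrix ((S.unobs (k + 1) q).map
      (Matrix.toEuclideanLin (NormedSpace.exp (-(S.τ k) • (Q k).Adiff))))ᗮ
  have hUimp : ∀ k, ∃ U : Matrix (Fin (n - 1) × Fin l) (Fin _) ℝ,
      -((Q k).Oimp (S.C k)).transpose * U = Zi k := by
    intro k
    obtain ⟨U, hU⟩ := exists_mul_eq_of_colSpace_le (colSpace_orthonormalMatrix
      (colSpace ((Q k).Oimp (S.C k)).transpose)).le
    exact ⟨-U, by rw [Matrix.neg_mul, Matrix.mul_neg, neg_neg, hU]⟩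
  have hUobs : ∀ k, ∃ U : Matrix (Fin _ ⊕ Fin _) (Fin _) ℝ,
      Matrix.fromCols ((Q k).proj.transpose * Zd k) (Zi k) * U = Z k := by
    intro k
    apply exists_mul_eq_of_colSpace_le
    rw [colSpace_orthonormalMatrix]
    refine colSpace_le_of_orthogonal_le fun v hv => ?_
    obtain ⟨h1, h2⟩ := fromCols_transpose_mulVec_eq_zero (mem_colSpace_orthogonal.1 hv)
    rw [Matrix.transpose_mul, Matrix.transpose_transpose, ← Matrix.mulVec_mulVec,
      ← ofLp_mulMat (Q k).proj,
      ← mem_colSpace_orthogonal, colSpace_orthonormalMatrix, mem_colSpace_orthogonal,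
      Matrix.transpose_transpose] at h1
    rw [← mem_colSpace_orthogonal, colSpace_orthonormalMatrix, mem_colSpace_orthogonal,
      Matrix.transpose_transpose] at h2
    exact mem_localUnobs (Q k) h1 h2
  have hU : ∀ k, ∃ U : Matrix (Fin _ ⊕ Fin _) (Fin _) ℝ, k + 1 < q →
      Matrix.fromCols (Z k) ((Q k).proj.transpose * Θ k) * U = M k := by
    intro k
    by_cases hk : k + 1 < q
    swap
    · exact ⟨0, fun h => absurd h hk⟩
    refine (exists_mul_eq_of_colSpace_le ?_).imp fun U hU _ => hU
    rw [colSpace_orthonormalMatrix]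
    refine colSpace_le_of_orthogonal_le fun v hv => ?_
    obtain ⟨h1, h2⟩ := fromCols_transpose_mulVec_eq_zero (mem_colSpace_orthogonal.1 hv)
    rw [← mem_colSpace_orthogonal, colSpace_orthonormalMatrix,
      Submodule.orthogonal_orthogonal] at h1
    rw [Matrix.transpose_mul, Matrix.transpose_transpose, ← Matrix.mulVec_mulVec,
      ← ofLp_mulMat (Q k).proj,
      ← mem_colSpace_orthogonal, colSpace_orthonormalMatrix,
      Submodule.orthogonal_orthogonal] at h2
    obtain ⟨w, hw, hw'⟩ := h2
    refine mem_unobs (Q k) h1 ?_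
    have : mulMat (NormedSpace.exp (-(S.τ k) • (Q k).Adiff)) w = mulMat (Q k).proj v := hw'
    rwa [← this, ← mulMat_mul, exp_smul_mul_exp_neg_smul, mulMat_one]
  choose Uimp hUimp using hUimp
  choose Uobs hUobs using hUobs
  choose U hU using hU
  -- In the last mode the two unobservable spaces coincide by definition, so the same basis matrix
  -- serves as `Z_{q-1}` and `M_{q-1}^q`.
  have hcast : ∀ k, k + 1 = q → S.localUnobs k = S.unobs k q := by
    rintro k rfl
    rfl
  exact ⟨{
    qwf := Q
    dDiff := _
    dImp := _
    dZ := _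
    dM := _
    dΘ := _
    Zdiff := Zd
    Zdiff_orth := fun k _ _ => orthonormalMatrix_transpose_mul _
    Zdiff_im := fun k _ _ => colSpace_orthonormalMatrix _
    Zimp := Zi
    Zimp_orth := fun k _ _ => orthonormalMatrix_transpose_mul _
    Zimp_im := fun k _ _ => colSpace_orthonormalMatrix _
    Z := Z
    Z_orth := fun k _ _ => orthonormalMatrix_transpose_mul _
    Z_im := fun k _ _ => colSpace_orthonormalMatrix _
    Uimp := Uimp
    Uimp_eq := fun k _ _ => hUimp k
    Uobs := Uobs
    Uobs_eq := fun k _ _ => (hUobs k).symm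
    M := M
    M_orth := fun k _ _ => orthonormalMatrix_transpose_mul _
    M_im := fun k _ _ => colSpace_orthonormalMatrix _
    dM_last := fun k h => by rw [hcast k h]
    M_last := by
      rintro k rfl
      rfl
    Θ := Θ
    Θ_im := fun k _ _ => colSpace_orthonormalMatrix _
    U := U
    U_eq := fun k _ h => (hU k h).symm }⟩

end SwitchedDAE

end Design

/-! ### The correction computed from a design -/

namespace SwitchedDAE

namespace ObserverDesign

open PWDist

variable {n m l : ℕ} {S : SwitchedDAE n m l} {p q : ℕ} (d : S.ObserverDesign p q) {k : ℕ}
  {e : PWDist (EuclideanSpace ℝ (Fin n))} {y y' : PWDist (EuclideanSpace ℝ (Fin l))}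

/-! ### The reduced observable ODE and the local data -/

theorem Zdiff_transpose_mulVec_eq_zero_iff (hk : p ≤ k) (hk' : k < q)
    {v : EuclideanSpace ℝ (Fin n)} : mulMat (d.Zdiff k).transpose v = 0 ↔
      ∀ i, mulMat ((d.qwf k).Cdiff (S.C k) * (d.qwf k).Adiff ^ i) v = 0 := by
  rw [← QuasiWeierstrass.Odiff_mulVec_eq_zero_iff, ← WithLp.ofLp_eq_zero 2, ofLp_mulMat,
    ← mem_colSpace_orthogonal, d.Zdiff_im k hk hk', mem_colSpace_orthogonal,
    Matrix.transpose_transpose]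

/-- Projecting onto the image of `Z^diff` discards only a component in the kernel of every `C^diff
(A^diff)^i`. -/
theorem mulMat_Zdiff_Zdiff_transpose (hk : p ≤ k) (hk' : k < q) (i : ℕ)
    (v : EuclideanSpace ℝ (Fin n)) :
    mulMat ((d.qwf k).Cdiff (S.C k) * (d.qwf k).Adiff ^ i)
      (mulMat (d.Zdiff k) (mulMat (d.Zdiff k).transpose v)) =
    mulMat ((d.qwf k).Cdiff (S.C k) * (d.qwf k).Adiff ^ i) v := by
  have h : mulMat (d.Zdiff k).transpose
      (v - mulMat (d.Zdiff k) (mulMat (d.Zdiff k).transpose v)) = 0 := by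
    rw [map_sub, ← mulMat_mul, d.Zdiff_orth k hk hk', mulMat_one, sub_self]
  have h1 := (d.Zdiff_transpose_mulVec_eq_zero_iff hk hk').1 h i
  rw [map_sub, sub_eq_zero] at h1
  exact h1.symm

/-- The discarded component stays unobservable under `A^diff`, so the coordinates `(Z^diff)ᵀ e` obey
a closed ODE. -/
theorem mulMat_Sdiff_Zdiff_transpose (hk : p ≤ k) (hk' : k < q) (v : EuclideanSpace ℝ (Fin n)) :
    mulMat (d.Sdiff k) (mulMat (d.Zdiff k).transpose v) =
      mulMat (d.Zdiff k).transpose (mulMat (d.qwf k).Adiff v) := by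
  rw [Sdiff, mulMat_mul, mulMat_mul, ← sub_eq_zero, ← map_sub, ← map_sub,
    d.Zdiff_transpose_mulVec_eq_zero_iff hk hk']
  intro i
  rw [← mulMat_mul, Matrix.mul_assoc, ← pow_succ, map_sub,
    d.mulMat_Zdiff_Zdiff_transpose hk hk', sub_self]

theorem mulMat_Rdiff_mul_Sdiff_pow (hk : p ≤ k) (hk' : k < q) (i : ℕ)
    (w : EuclideanSpace ℝ (Fin (d.dDiff k))) :
    mulMat (d.Rdiff k * d.Sdiff k ^ i) w =
      mulMat ((d.qwf k).Cdiff (S.C k) * (d.qwf k).Adiff ^ i) (mulMat (d.Zdiff k) w) := by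
  induction i generalizing w with
  | zero => rw [pow_zero, pow_zero, Matrix.mul_one, Matrix.mul_one, Rdiff, mulMat_mul]
  | succ i ih =>
    rw [pow_succ, ← Matrix.mul_assoc, mulMat_mul _ (d.Sdiff k), ih, Sdiff,
      mulMat_mul _ (d.Zdiff k), mulMat_mul _ (d.qwf k).Adiff,
      d.mulMat_Zdiff_Zdiff_transpose hk hk', ← mulMat_mul, Matrix.mul_assoc, ← pow_succ]

theorem IsDiffTrajectory.hasDerivAt_toLp {d : S.ObserverDesign p q}
    {z : ℝ → Fin (d.dDiff k) → ℝ} (hz : d.IsDiffTrajectory k y z) {s : ℝ}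
    (hs : s ∈ Ioo (S.t k) (S.t (k + 1))) :
    HasDerivAt (fun r => (WithLp.toLp 2 (z r) : EuclideanSpace ℝ (Fin (d.dDiff k))))
      (mulMat (d.Sdiff k) (WithLp.toLp 2 (z s))) s :=
  ((PiLp.continuousLinearEquiv 2 ℝ fun _ : Fin (d.dDiff k) =>
    ℝ).symm.hasFDerivAt (x := z s)).comp_hasDerivAt s (hz s hs).1

/-- The ODE `z' = S_k^diff z` with output `R_k^diff z` is observable. -/
theorem IsDiffTrajectory.eqOn {d : S.ObserverDesign p q} (hk : p ≤ k) (hk' : k < q)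
    {z z' : ℝ → Fin (d.dDiff k) → ℝ} (hz : d.IsDiffTrajectory k y z)
    (hz' : d.IsDiffTrajectory k y z') : EqOn z z' (Ioo (S.t k) (S.t (k + 1))) := by
  set w : ℝ → EuclideanSpace ℝ (Fin (d.dDiff k)) :=
    fun s => WithLp.toLp 2 (z s) - WithLp.toLp 2 (z' s) with hw
  have hder : ∀ s ∈ Ioo (S.t k) (S.t (k + 1)), HasDerivAt w (mulMat (d.Sdiff k) (w s)) s := by
    intro s hs
    rw [hw, map_sub]
    exact (hz.hasDerivAt_toLp hs).sub (hz'.hasDerivAt_toLp hs)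
  -- Two trajectories have the same output on an open interval; differentiating its vanishing
  -- difference `i` times gives `R S^i w = 0`.
  have key : ∀ i, ∀ s ∈ Ioo (S.t k) (S.t (k + 1)),
      mulMat (d.Rdiff k * d.Sdiff k ^ i) (w s) = 0 := by
    intro i
    induction i with
    | zero =>
      intro s hs
      have h : mulMat (d.Rdiff k) (WithLp.toLp 2 (z s)) =
          mulMat (d.Rdiff k) (WithLp.toLp 2 (z' s)) := (hz s hs).2.symm.trans (hz' s hs).2
      rw [pow_zero, Matrix.mul_one, hw, map_sub, h, sub_self]
    | succ i ih =>
      intro s hs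
      have h1 := (mulMat (d.Rdiff k * d.Sdiff k ^ i)).hasFDerivAt.comp_hasDerivAt s (hder s hs)
      have h2 : (mulMat (d.Rdiff k * d.Sdiff k ^ i)) ∘ w =ᶠ[𝓝 s] fun _ => 0 := by
        filter_upwards [isOpen_Ioo.mem_nhds hs] with r hr
        exact ih r hr
      have h3 := h1.unique ((hasDerivAt_const s _).congr_of_eventuallyEq h2)
      rw [pow_succ, ← Matrix.mul_assoc, mulMat_mul]
      exact h3
  intro s hs
  -- Thus `Z^diff w` is unobservable, hence orthogonal to the columns of `Z^diff`; orthonormality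
  -- forces `w = 0`.
  have h : mulMat (d.Zdiff k).transpose (mulMat (d.Zdiff k) (w s)) = 0 := by
    rw [d.Zdiff_transpose_mulVec_eq_zero_iff hk hk']
    intro i
    rw [← d.mulMat_Rdiff_mul_Sdiff_pow hk hk', key i s hs]
  rw [← mulMat_mul, d.Zdiff_orth k hk hk', mulMat_one] at h
  exact congrArg WithLp.ofLp (sub_eq_zero.1 h)

theorem isDiffTrajectory_of_isModeSolution (hk : p ≤ k) (hk' : k < q)
    (he : IsModeSolution (S.E k) (S.A k) (S.t k) (S.t (k + 1)) e)
    (hy : ∀ s ∈ Ioo (S.t k) (S.t (k + 1)), reg y s = mulMat (S.C k) (reg e s)) :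
    d.IsDiffTrajectory k y fun s => (mulMat (d.Zdiff k).transpose (reg e s)).ofLp := by
  intro s hs
  constructor
  · have h1 : HasDerivAt (reg e) (mulMat (d.qwf k).Adiff (reg e s)) s := by
      rw [he.reg_eq (d.qwf k) (Ioo_subset_Ico_self hs)]
      refine (hasDerivAt_mulMat_exp _ _ _ s).congr_of_eventuallyEq ?_
      filter_upwards [isOpen_Ioo.mem_nhds hs] with r hr
      exact he.reg_eq (d.qwf k) (Ioo_subset_Ico_self hr)
    have h2 := (mulMat (d.Zdiff k).transpose).hasFDerivAt.comp_hasDerivAt s h1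
    rw [← d.mulMat_Sdiff_Zdiff_transpose hk hk'] at h2
    exact ((PiLp.continuousLinearEquiv 2 ℝ fun _ : Fin (d.dDiff k) =>
      ℝ).hasFDerivAt).comp_hasDerivAt s h2
  · have h := d.mulMat_Zdiff_Zdiff_transpose hk hk' 0 (reg e s)
    rw [pow_zero, Matrix.mul_one, ← mulMat_mul, ← Rdiff, QuasiWeierstrass.Cdiff,
      mulMat_mul _ (d.qwf k).proj, he.proj_reg _ (Ioo_subset_Ico_self hs), ← hy s hs] at h
    exact h.symm

/-- The coordinates `(Z^diff)ᵀ e` are a trajectory producing `y`, so by observability the chosen one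
agrees with them on the open interval. The right limit at `t_k` is governed by `e(t_k⁺) = Π
e(t_k⁻)`. -/
theorem zdiff_eq (hk : p ≤ k) (hk' : k < q)
    (he : IsModeSolution (S.E k) (S.A k) (S.t k) (S.t (k + 1)) e)
    (hy : ∀ s ∈ Ioo (S.t k) (S.t (k + 1)), reg y s = mulMat (S.C k) (reg e s)) :
    d.zdiff k y =
      (mulMat (d.Zdiff k).transpose (mulMat (d.qwf k).proj (leftVal (S.t k) e))).ofLp := by
  have hlt : S.t k < S.t (k + 1) := S.t_strictMono (Nat.lt_succ_self k)
  have hmem : S.t k ∈ Ico (S.t k) (S.t (k + 1)) := ⟨le_rfl, hlt⟩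
  have h1 := d.isDiffTrajectory_of_isModeSolution hk hk' he hy
  have h2 : ∃ z, d.IsDiffTrajectory k y z := ⟨_, h1⟩
  have h3 : d.IsDiffTrajectory k y (d.diffObs k y) := by
    rw [diffObs, dif_pos h2]
    exact h2.choose_spec
  rw [← he.proj_jump (d.qwf k) hmem, he.proj_reg (d.qwf k) hmem]
  refine Tendsto.limUnder_eq (Tendsto.congr' (f₁ := fun s =>
    (mulMat (d.Zdiff k).transpose (reg e s)).ofLp) ?_ ?_)
  · filter_upwards [Ioo_mem_nhdsGT hlt] with s hs
    exact h1.eqOn hk hk' h3 hs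
  · exact (((PiLp.continuous_ofLp 2 _).comp
      (mulMat (d.Zdiff k).transpose).continuous).tendsto _).comp (tendsto_rightVal e (S.t k))

/-- The stacked impulse coefficients are `-O^imp e(t_k⁻)`; the minus sign cancels the one in the
equation defining `U^imp`. -/
theorem zimp_eq (hk : p ≤ k) (hk' : k < q)
    (he : IsModeSolution (S.E k) (S.A k) (S.t k) (S.t (k + 1)) e)
    (hy : ∀ j, imp y (S.t k) j = mulMat (S.C k) (imp e (S.t k) j)) :
    d.zimp k y = (mulMat (d.Zimp k).transpose (leftVal (S.t k) e)).ofLp := by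
  have hmem : S.t k ∈ Ico (S.t k) (S.t (k + 1)) :=
    ⟨le_rfl, S.t_strictMono (Nat.lt_succ_self k)⟩
  have h1 : (fun i : Fin (n - 1) × Fin l => imp y (S.t k) (i.1 : ℕ) i.2) =
      -((d.qwf k).Oimp (S.C k)).mulVec (leftVal (S.t k) e).ofLp := by
    funext ⟨i, r⟩
    rw [hy, he.imp_eq (d.qwf k) hmem, map_neg, ← mulMat_mul]
    rfl
  rw [zimp, h1, ofLp_mulMat, ← d.Uimp_eq k hk hk', Matrix.transpose_mul, Matrix.transpose_neg,
    Matrix.transpose_transpose, Matrix.mul_neg, Matrix.neg_mulVec, Matrix.mulVec_neg,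
    Matrix.mulVec_mulVec]

theorem z_eq (hk : p ≤ k) (hk' : k < q)
    (he : IsModeSolution (S.E k) (S.A k) (S.t k) (S.t (k + 1)) e)
    (hy : ∀ s ∈ Ico (S.t k) (S.t (k + 1)), reg y s = mulMat (S.C k) (reg e s) ∧
      ∀ j, imp y s j = mulMat (S.C k) (imp e s j)) :
    d.z y k = (d.Z k).transpose.mulVec (leftVal (S.t k) e).ofLp := by
  have hmem : S.t k ∈ Ico (S.t k) (S.t (k + 1)) :=
    ⟨le_rfl, S.t_strictMono (Nat.lt_succ_self k)⟩
  rw [z, localObs, d.zdiff_eq hk hk' he, d.zimp_eq hk hk' he, d.Uobs_eq k hk hk',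
    Matrix.transpose_mul, ← Matrix.mulVec_mulVec, Matrix.transpose_fromCols,
    Matrix.fromRows_mulVec, Matrix.transpose_mul, Matrix.transpose_transpose,
    ← Matrix.mulVec_mulVec]
  · rfl
  · intro j
    rw [imp_restrict_of_mem hmem, (hy _ hmem).2]
  · intro s hs
    rw [reg_restrict_of_mem (Ioo_subset_Ico_self hs), (hy _ (Ioo_subset_Ico_self hs)).1]

theorem F_mulVec (a : Fin (d.dZ k) → ℝ) (b : Fin (d.dM (k + 1)) → ℝ) :
    (d.F k).mulVec (Sum.elim a b) = (d.U k).transpose.mulVec (Sum.elim a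
      ((d.Θ k).transpose.mulVec ((NormedSpace.exp (-(S.τ k) • (d.qwf k).Adiff)).mulVec
        ((d.M (k + 1)).mulVec b)))) := by
  refine (Matrix.mulVec_mulVec (Sum.elim a b) (d.U k).transpose (Matrix.fromBlocks 1 0 0
    ((d.Θ k).transpose * NormedSpace.exp (-(S.τ k) • (d.qwf k).Adiff) *
      d.M (k + 1)))).symm.trans ?_
  rw [Matrix.fromBlocks_mulVec]
  simp [Matrix.mulVec_mulVec, Matrix.mul_assoc]

/-- Backward induction from `q - 1`. What the projection `M_{k+1} M_{k+1}ᵀ` loses of `v (k + 1)`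
lies in `𝒩_{k+1}^q`, and `Θ_kᵀ exp(-A^diff τ_k)` annihilates that space. The projection may
therefore replace `v (k + 1)`, and the exponential undoes the flow to leave `Θ_kᵀ Π v_k`. -/
theorem mu_eq {z : ∀ k, Fin (d.dZ k) → ℝ} {v : ℕ → EuclideanSpace ℝ (Fin n)}
    (hz : ∀ k, p ≤ k → k < q → z k = (d.Z k).transpose.mulVec (v k).ofLp)
    (hv : ∀ k, p ≤ k → k + 1 < q → v (k + 1) =
      mulMat (NormedSpace.exp (S.τ k • (d.qwf k).Adiff)) (mulMat (d.qwf k).proj (v k)))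
    (hk : p ≤ k) (hk' : k < q) : d.mu z k = (d.M k).transpose.mulVec (v k).ofLp := by
  obtain ⟨j, hj⟩ : ∃ j, k + 1 + j = q := ⟨q - (k + 1), by omega⟩
  induction j generalizing k with
  | zero =>
    have h : k + 1 = q := hj
    rw [mu, dif_pos h, hz k hk hk', d.M_last k h]
    rfl
  | succ j ih =>
    have h1 : k + 1 < q := by omega
    rw [mu, dif_neg h1.ne, if_pos h1, ih (by omega) h1 (by omega), hz k hk hk',
      F_mulVec, d.U_eq k hk h1, Matrix.transpose_mul, ← Matrix.mulVec_mulVec,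
      Matrix.transpose_fromCols, Matrix.fromRows_mulVec, Matrix.transpose_mul,
      Matrix.transpose_transpose, ← Matrix.mulVec_mulVec]
    have h2 : (d.Θ k).transpose.mulVec (mulMat (NormedSpace.exp (-(S.τ k) • (d.qwf k).Adiff))
        (v (k + 1) - mulMat (d.M (k + 1)) (mulMat (d.M (k + 1)).transpose (v (k + 1))))).ofLp
        = 0 := by
      rw [← mem_colSpace_orthogonal, d.Θ_im k hk h1, Submodule.orthogonal_orthogonal]
      refine Submodule.mem_map_of_mem ?_
      have := sub_mul_transpose_mem (d.M_orth (k + 1) (by omega) h1) (v (k + 1))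
      rwa [d.M_im (k + 1) (by omega) h1, Submodule.orthogonal_orthogonal] at this
    have h3 : mulMat (NormedSpace.exp (-(S.τ k) • (d.qwf k).Adiff)) (v (k + 1)) =
        mulMat (d.qwf k).proj (v k) := by
      rw [hv k hk h1, ← mulMat_mul, exp_neg_smul_mul_exp_smul, mulMat_one]
    rw [map_sub, h3, WithLp.ofLp_sub, Matrix.mulVec_sub, sub_eq_zero] at h2
    rw [← ofLp_mulMat (d.qwf k).proj, h2]
    rfl

theorem mulMat_Phi_leftVal (he : ∀ k, p ≤ k → k < q →
      IsModeSolution (S.E k) (S.A k) (S.t k) (S.t (k + 1)) e) {j : ℕ} (hj : p + j ≤ q) :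
    mulMat (d.Phi j) (leftVal (S.t p) e) = leftVal (S.t (p + j)) e := by
  induction j with
  | zero => rw [Phi, mulMat_one, add_zero]
  | succ j ih =>
    rw [Phi, mulMat_mul, mulMat_mul, ih (by omega), ← add_assoc, τ,
      (he (p + j) (by omega) (by omega)).leftVal_eq (d.qwf (p + j))
        (S.t_strictMono (Nat.lt_succ_self _))]

end ObserverDesign

/-- Detectability bounds the left limit at `t_q`. -/
theorem IsIntervalDetectable.leftVal_le {n m l : ℕ} {S : SwitchedDAE n m l} {p q : ℕ}
    (hpq : p < q) {β : ℝ≥0 → ℝ≥0 → ℝ≥0} (hβ : S.IsIntervalDetectable p q β)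
    (hβ_left : ∀ r, ContinuousWithinAt (β r) (Iic (S.t q - S.t p).toNNReal)
      (S.t q - S.t p).toNNReal) {x : PWDist (EuclideanSpace ℝ (Fin n))}
    (hx : S.IsSolution p q x 0 0) :
    ‖PWDist.leftVal (S.t q) x‖₊ ≤ β ‖PWDist.leftVal (S.t p) x‖₊ (S.t q - S.t p).toNNReal := by
  have hlt := S.t_strictMono hpq
  -- The elapsed time tends to `t_q - t_p` from below, so one-sided continuity of `β` is enough to
  -- pass to the limit.
  have h1 : Tendsto (fun t => (t - S.t p).toNNReal) (𝓝[<] S.t q)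
      (𝓝[≤] (S.t q - S.t p).toNNReal) := by
    refine tendsto_nhdsWithin_of_tendsto_nhds_of_eventually_within _ ?_ ?_
    · have : Continuous fun t => (t - S.t p).toNNReal := by fun_prop
      exact (this.tendsto _).mono_left nhdsWithin_le_nhds
    · filter_upwards [self_mem_nhdsWithin] with t ht
      exact Real.toNNReal_le_toNNReal (sub_le_sub_right (le_of_lt ht) _)
  refine le_of_tendsto_of_tendsto (PWDist.tendsto_leftVal x (S.t q)).nnnorm
    ((hβ_left ‖PWDist.leftVal (S.t p) x‖₊).tendsto.comp h1) ?_
  filter_upwards [Ioo_mem_nhdsLT hlt] with t ht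
  exact hβ.le x hx t (Ioo_subset_Ico_self ht)

end SwitchedDAE

/-! ### The correction theorem -/

theorem theorem1 {n m l : ℕ} (S : SwitchedDAE n m l)
    (hreg : ∀ k, IsRegularPair (S.E k) (S.A k))
    {p q : ℕ} (hpq : p < q) (β : ℝ≥0 → ℝ≥0 → ℝ≥0) (hβ : S.IsIntervalDetectable p q β)
    (hβ_left : ∀ r, ContinuousWithinAt (β r) (Iic (S.t q - S.t p).toNNReal)
      (S.t q - S.t p).toNNReal) :
    Nonempty (S.ObserverDesign p q) ∧
    ∀ (d : S.ObserverDesign p q)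
      (x xhat : PWDist (EuclideanSpace ℝ (Fin n))) (u : PWDist (EuclideanSpace ℝ (Fin m)))
      (y yhat : PWDist (EuclideanSpace ℝ (Fin l))),
      S.IsSolution p q x u y → S.IsSolution p q xhat u yhat →
      (∀ k, p ≤ k → k < q → d.z (yhat - y) k =
        (d.Z k).transpose.mulVec (PWDist.leftVal (S.t k) (xhat - x)).ofLp) ∧
      d.ξleft (yhat - y) ∈ (S.unobs p q)ᗮ ∧
      PWDist.leftVal (S.t p) (xhat - x) - d.ξleft (yhat - y) ∈ S.unobs p q ∧
      ‖PWDist.leftVal (S.t q) xhat - d.ξ (yhat - y) - PWDist.leftVal (S.t q) x‖₊ ≤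
        β ‖PWDist.leftVal (S.t p) xhat - PWDist.leftVal (S.t p) x‖₊ (S.t q - S.t p).toNNReal ∧
      (PWDist.leftVal (S.t p) xhat ≠ PWDist.leftVal (S.t p) x →
        β ‖PWDist.leftVal (S.t p) xhat - PWDist.leftVal (S.t p) x‖₊ (S.t q - S.t p).toNNReal <
          ‖PWDist.leftVal (S.t p) xhat - PWDist.leftVal (S.t p) x‖₊) := by
  refine ⟨S.nonempty_observerDesign hreg p q, fun d x xhat u y yhat hx hxhat => ?_⟩
  have hsol := hx.sub hxhat
  have hmode := SwitchedDAE.isSolution_zero_iff.1 hsol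
  have hz : ∀ k, p ≤ k → k < q → d.z (yhat - y) k =
      (d.Z k).transpose.mulVec (PWDist.leftVal (S.t k) (xhat - x)).ofLp := fun k hk hk' =>
    d.z_eq hk hk' (hmode k hk hk').1 (hmode k hk hk').2
  have hξ : d.ξleft (yhat - y) =
      mulMat (d.M p) (mulMat (d.M p).transpose (PWDist.leftVal (S.t p) (xhat - x))) := by
    apply WithLp.ofLp_injective
    rw [ofLp_mulMat, ofLp_mulMat, ← d.mu_eq hz (fun k hk hk' => (hmode k hk (by omega)).1.leftVal_eq
      (d.qwf k) (S.t_strictMono (Nat.lt_succ_self k))) le_rfl hpq]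
    rfl
  have hmem : d.ξleft (yhat - y) ∈ (S.unobs p q)ᗮ := by
    rw [← d.M_im p le_rfl hpq, hξ]
    exact ⟨_, rfl⟩
  have hmem' : PWDist.leftVal (S.t p) (xhat - x) - d.ξleft (yhat - y) ∈ S.unobs p q := by
    have := sub_mul_transpose_mem (d.M_orth p le_rfl hpq) (PWDist.leftVal (S.t p) (xhat - x))
    rwa [d.M_im p le_rfl hpq, Submodule.orthogonal_orthogonal, ← hξ] at this
  refine ⟨hz, hmem, hmem', ?_, fun hne => hβ.lt _ ?_⟩
  -- Here `e` is a zero-output solution starting from the uncorrected remainder. The matrix `Φ`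
  -- moves both its left limit and that of `xhat - x` to `t_q`, so its left limit there is the
  -- corrected error.
  · obtain ⟨e, he, hel⟩ := id hmem'
    have hq : p + (q - p) = q := by omega
    have h1 := d.mulMat_Phi_leftVal (fun k hk hk' => (hmode k hk hk').1) hq.le
    have h2 := d.mulMat_Phi_leftVal
      (fun k hk hk' => (SwitchedDAE.isSolution_zero_iff.1 he k hk hk').1) hq.le
    rw [hq] at h1 h2
    have h3 : PWDist.leftVal (S.t q) xhat - d.ξ (yhat - y) - PWDist.leftVal (S.t q) x =
        PWDist.leftVal (S.t q) e := by
      rw [← h2, hel, map_sub (mulMat _), h1, map_sub]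
      exact sub_right_comm _ _ _
    rw [h3, ← map_sub]
    refine (hβ.leftVal_le hpq hβ_left he).trans ((hβ.isClassKL.strictMono _).monotone ?_)
    -- The remainder and `ξ^left` are orthogonal, so Pythagoras bounds the remainder by the whole
    -- initial error.
    have h4 : inner ℝ (d.ξleft (yhat - y)) (PWDist.leftVal (S.t p) e) = 0 := by
      rw [hel, real_inner_comm]
      exact hmem _ hmem'
    have h5 : PWDist.leftVal (S.t p) (xhat - x) =
        d.ξleft (yhat - y) + PWDist.leftVal (S.t p) e := by
      rw [hel, add_sub_cancel]
    have h6 := norm_add_sq_eq_norm_sq_add_norm_sq_of_inner_eq_zero _ _ h4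
    rw [← h5] at h6
    rw [← NNReal.coe_le_coe, coe_nnnorm, coe_nnnorm]
    nlinarith [norm_nonneg (d.ξleft (yhat - y)), norm_nonneg (PWDist.leftVal (S.t p) e),
      norm_nonneg (PWDist.leftVal (S.t p) (xhat - x)), mul_self_nonneg ‖d.ξleft (yhat - y)‖]
  · exact nnnorm_pos.2 (sub_ne_zero.2 hne)
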